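/- Let $\kappa_1<\kappa_2<\kappa_3<\kappa_4$ be real and let $A$ be a real $2\times4$ matrix with all maximal minors positive, so $[A]\in Gr^{TP}(2,4)$. For $\vec t=(x,y,t)\in\mathbb R^3$ put $\theta(\zeta,\vec t)=\zeta x+\zeta^2y+\zeta^3t$, $\theta_l(\vec t)=\theta(\kappa_l,\vec t)$, $f^{(i)}=\sum_jA^i_je^{\theta_j}$ $(i=1,2)$, and let $\mathfrak D=\partial_x^2-\mathfrak w_1(\vec t)\partial_x-\mathfrak w_2(\vec t)$ be the operator with $\mathfrak Df^{(1)}=\mathfrak Df^{(2)}=0$. It is uniquely determined, and $\mathfrak De^{\theta_1}>0$, $\mathfrak De^{\theta_4}>0$ for all $\vec t$. There are unique weights $w_{13},w_{14},w_{23},w_{24}>0$ such that $A$ equals, up to left multiplication by a matrix of positive determinant, $$\begin{pmatrix}1&0&-w_{13}&-w_{13}(w_{14}+w_{24})\\0&1&w_{23}&w_{23}w_{24}\end{pmatrix}.$$ **The curve.** $\Gamma=\Gamma(\mathcal N_{T,red})$ consists of five copies $\Gamma_0,\Gamma_{13},\Gamma_{23},\Sigma_{23},\Sigma_{24}$ of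 $\mathbb{CP}^1$, with coordinate $\zeta$, glued at eight double points, one for each edge of the reduced Le-network $\mathcal N_{T,red}$: the points $\kappa_1,\kappa_2,\kappa_3,\kappa_4$ of $\Gamma_0$ are glued to $\infty\in\Gamma_{13}$, to $\Sigma_{23}$, to $1\in\Gamma_{23}$ and to $\Sigma_{24}$, respectively; $1,0\in\Gamma_{13}$ are glued to $\Sigma_{23}$ and $\Sigma_{24}$, respectively; $\infty,0\in\Gamma_{23}$ are glued to $\Sigma_{23}$ and $\Sigma_{24}$, respectively. Let $P_0=\infty\in\Gamma_0$. The real part of $\Gamma$ is the union of five ovals, the closed curves corresponding to the faces of the network and made of real arcs between consecutive double points: $b_1,b_2,b_3$, which meet $\Gamma_0$ in $[\kappa_1,\kappa_2]$, $[\kappa_2,\kappa_3]$, $[\kappa_3,\kappa_4]$; $b_4$, which does not meet $\Gamma_0$; and $\Omega_0$, which contains $P_0$. On $\Gamma_{13}$ the arcs $[1,\infty]$, $[0,1]$, $[-\infty,0]$ belong to $b_1,b_4,\Omega_0$, and on $\Gamma_{23}$ the arcs $[1,\infty]$, $[0,1]$, $[-\infty,0]$ belong to $b_2,b_3,b_4$;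 on $\Sigma_{23}$ and on $\Sigma_{24}$ each oval with two double points there contains the arc between them that avoids the third one. The ovals $b_1,\dots,b_4$ are called finite. **Wavefunction and divisor.** Let $\vec t_0\in\mathbb R^3$, and call the data generic if $\mathfrak De^{\theta_l(\vec t_0)}\ne0$ for all $l$. A normalized KP wavefunction is a function $\hat\psi(P,\vec t)$ on $\Gamma\setminus\{P_0\}$ that equals $\mathfrak De^{\theta(\zeta,\vec t)}/\mathfrak De^{\theta(\zeta,\vec t_0)}$ on $\Gamma_0$, is constant in $P$ on $\Sigma_{23}$ and on $\Sigma_{24}$, is meromorphic of degree at most $1$ on $\Gamma_{13}$ and on $\Gamma_{23}$, and agrees at the two points of each double point. For generic data its pole divisor, i.e. the least effective divisor $\mathcal D$ on $\Gamma\setminus\{P_0\}$ with $(\hat\psi(\cdot,\vec t))+\mathcal D\ge0$ for all $\vec t$, is the KP-II divisor. For arbitrary $\vec t_0$ the KP-II divisor is the dressed divisor: the zeros of $\zeta^2-\mathfrak w_1(\vec t_0)\zeta-\mathfrak w_2(\vec t_0)$ on $\Gamma_0$, and, on $\Gamma_{13}$ and on $\Gamma_{23}$, the point $\zeta=\Psi'/(\Psi'+\Psi'')$,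 where $\Psi',\Psi''$ are the values at $\vec t_0$ of the dressed edge wavefunction $\Psi_e=\mathfrak D\Phi_e$ on the edges of the network at $\zeta=0$ and $\zeta=1$ (with $\zeta=\infty$ if $\Psi'+\Psi''=0$). Here the vacuum edge wavefunction $\Phi_e$ is $e^{\theta_3}$, $e^{\theta_4}$ on the edges at the boundary sinks $b_3,b_4$, and on any other edge it is the weight of the edge times the sum of $\Phi$ over the edges leaving its head. **Theorem.** 1. For generic data the normalized KP wavefunction exists and is unique, its value at the double point of an edge $e$ is $\Psi_e(\vec t)/\Psi_e(\vec t_0)$, and its pole divisor is the dressed divisor. 2. For every $\vec t_0$ the KP-II divisor is $P_1+P_2+P_{13}+P_{23}$ with $P_1,P_2\in\Gamma_0$ distinct, $\zeta(P_1),\zeta(P_2)\in[\kappa_1,\kappa_4]$, $P_{13}\in\Gamma_{13}$, $P_{23}\in\Gamma_{23}$ and $$\zeta(P_1)+\zeta(P_2)=\mathfrak w_1(\vec t_0),\qquad \zeta(P_1)\zeta(P_2)=-\mathfrak w_2(\vec t_0),$$ $$\zeta(P_{13})=\frac{w_{14}\,\mathfrak De^{\theta_4(\vec t_0)}}{\mathfrak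 De^{\theta_3(\vec t_0)}+(w_{14}+w_{24})\,\mathfrak De^{\theta_4(\vec t_0)}},\qquad \zeta(P_{23})=\frac{w_{24}\,\mathfrak De^{\theta_4(\vec t_0)}}{\mathfrak De^{\theta_3(\vec t_0)}+w_{24}\,\mathfrak De^{\theta_4(\vec t_0)}}.$$ The first denominator is positive; the second vanishes exactly when $\mathfrak De^{\theta_2(\vec t_0)}=0$, and then $\zeta(P_{23})=\infty$. 3. The data are generic for an open dense set of $\vec t_0$. For generic data each finite oval contains exactly one divisor point, and, with $\zeta(P_1)<\zeta(P_2)$, exactly the following configurations occur, each of them for some $\vec t_0$: if $\mathfrak De^{\theta_2(\vec t_0)}<0<\mathfrak De^{\theta_3(\vec t_0)}$, then $P_1\in b_1$, $P_2\in b_2$, $P_{13}\in b_4$, $P_{23}\in b_3$; if both are negative, then $P_1\in b_1$, $P_2\in b_3$, $P_{13}\in b_4$, $P_{23}\in b_2$; if $\mathfrak De^{\theta_3(\vec t_0)}<0<\mathfrak De^{\theta_2(\vec t_0)}$, then $P_1\in b_2$, $P_2\in b_3$, $P_{13}\in b_1$, $P_{23}\in b_4$. 4. If $\mathfrak De^{\theta_2(\vec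 t_0)}=0$, then $\zeta(P_1)=\kappa_2$, $\kappa_3<\zeta(P_2)<\kappa_4$, $\zeta(P_{13})=1$ and $\zeta(P_{23})=\infty$. If $\mathfrak De^{\theta_3(\vec t_0)}=0$, then $\kappa_1<\zeta(P_1)<\kappa_2$, $\zeta(P_2)=\kappa_3$, $0<\zeta(P_{13})<1$ and $\zeta(P_{23})=1$. 5. For every $\vec t_0$ the oval $\Omega_0$ contains $P_0$ and no divisor point, and each finite oval contains exactly one divisor point, where a divisor point at a double point is counted in one of the two ovals that meet there: the four divisor points can be matched bijectively with the four finite ovals so that each point lies on its oval. -/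

import Mathlib

open scoped OnePoint Topology

noncomputable section

namespace KPGr24

/-! ### Soliton data and the dressing operator -/

/-- The space of times `(x, y, t)`. -/
abbrev Time := ℝ × ℝ × ℝ

/-- The derivative in `x`. -/
def dx {V : Type*} [NormedAddCommGroup V] [NormedSpace ℝ V] (F : Time → V) : Time → V :=
  fun s => deriv (fun x => F (x, s.2)) s.1

/-- `exp (θ(κ, s))` with `θ(κ, (x, y, t)) = κ x + κ² y + κ³ t`, for a real phase `κ`. -/
def expPhase (k : ℝ) (s : Time) : ℝ :=
  Real.exp (k * s.1 + k ^ 2 * s.2.1 + k ^ 3 * s.2.2)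

/-- `exp (θ(ζ, s))` for a complex spectral parameter `ζ`. -/
def expTheta (z : ℂ) (s : Time) : ℂ :=
  Complex.exp (z * (s.1 : ℂ) + z ^ 2 * (s.2.1 : ℂ) + z ^ 3 * (s.2.2 : ℂ))

/-- `A` represents a point of the totally positive Grassmannian: all maximal minors are positive. -/
def IsTotallyPositive (A : Matrix (Fin 2) (Fin 4) ℝ) : Prop :=
  ∀ i j : Fin 4, i < j → 0 < A 0 i * A 1 j - A 0 j * A 1 i

variable (κ : Fin 4 → ℝ) (A : Matrix (Fin 2) (Fin 4) ℝ)

/-- The heat hierarchy solutions `f⁽ⁱ⁾ = ∑ⱼ Aⁱⱼ Eⱼ`. -/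
def heatSol (i : Fin 2) (s : Time) : ℝ := ∑ j, A i j * expPhase (κ j) s

/-- The `τ`-function, i.e. the Wronskian in `x` of `f⁽¹⁾, f⁽²⁾`. -/
def tau (s : Time) : ℝ :=
  heatSol κ A 0 s * dx (heatSol κ A 1) s - heatSol κ A 1 s * dx (heatSol κ A 0) s

/-- The coefficient `𝔴₁` of `𝔇 = ∂ₓ² - 𝔴₁ ∂ₓ - 𝔴₂`, by Cramer's rule from `𝔇 f⁽ⁱ⁾ = 0`. -/
def coeff1 (s : Time) : ℝ :=
  (heatSol κ A 0 s * dx (dx (heatSol κ A 1)) s -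
    heatSol κ A 1 s * dx (dx (heatSol κ A 0)) s) / tau κ A s

/-- The coefficient `𝔴₂` of `𝔇 = ∂ₓ² - 𝔴₁ ∂ₓ - 𝔴₂`, by Cramer's rule from `𝔇 f⁽ⁱ⁾ = 0`. -/
def coeff2 (s : Time) : ℝ :=
  (dx (dx (heatSol κ A 0)) s * dx (heatSol κ A 1) s -
    dx (dx (heatSol κ A 1)) s * dx (heatSol κ A 0) s) / tau κ A s

/-- The dressing (Darboux) operator `𝔇 = ∂ₓ² - 𝔴₁ ∂ₓ - 𝔴₂`. -/
def darboux {V : Type*} [NormedAddCommGroup V] [NormedSpace ℝ V] (F : Time → V) : Time → V :=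
  fun s => dx (dx F) s - coeff1 κ A s • dx F s - coeff2 κ A s • F s

/-- `𝔇 exp(θ_l)` for the phase `κ_l`; here `l = 0, 1, 2, 3` stands for `1, 2, 3, 4`. -/
def dressedPhase (l : Fin 4) : Time → ℝ := darboux κ A (expPhase (κ l))

/-- The unnormalized Sato wavefunction `ψ⁽⁰⁾(ζ, s) = 𝔇 exp(θ(ζ, s))`. -/
def satoWave (z : ℂ) : Time → ℂ := darboux κ A (expTheta z)

/-! ### The reduced Le-network -/

/-- The weights of the Le-network. -/
structure Weights where
  w13 : ℝ
  w14 : ℝ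
  w23 : ℝ
  w24 : ℝ

/-- The matrix in reduced row echelon form with the given weights. -/
def Weights.rref (w : Weights) : Matrix (Fin 2) (Fin 4) ℝ :=
  !![1, 0, -w.w13, -w.w13 * (w.w14 + w.w24);
     0, 1, w.w23, w.w23 * w.w24]

/-- `w` are the weights of the Le-network of `[A]`: they are positive, and `A` and the reduced row
echelon form with weights `w` define the same point of `GL⁺(2) \ Mat(2,4)`. -/
def Weights.Represents (w : Weights) (A : Matrix (Fin 2) (Fin 4) ℝ) : Prop :=
  (0 < w.w13 ∧ 0 < w.w14 ∧ 0 < w.w23 ∧ 0 < w.w24) ∧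
    ∃ g : Matrix (Fin 2) (Fin 2) ℝ, 0 < g.det ∧ A = g * w.rref

/-- The oriented edges of the reduced Le-network. It has the boundary sources `b₁, b₂`, the boundary
sinks `b₃, b₄`, the trivalent white vertices `V₁₃, V₂₃` and the trivalent black vertices
`V'₂₃, V'₂₄`. The edges `b₁V₁₃`, `b₂V'₂₃`, `V₁₃V'₂₄`, `V₂₃V'₂₄` carry the weights `w₁₃`, `w₂₃`,
`w₁₄`, `w₂₄`, the others carry the weight `1`. -/
inductive Edge
  | b1_white13
  | b2_black23
  | white13_black23
  | white13_black24
  | black23_white23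
  | white23_black24
  | white23_b3
  | black24_b4

/-- The vacuum edge wavefunction: `E₃`, `E₄` at the sinks, and on every other edge its weight times
the sum over the edges that leave the head of the edge. -/
def vacuumWave (w : Weights) (e : Edge) (s : Time) : ℝ :=
  let v24b4 := expPhase (κ 3) s
  let v23b3 := expPhase (κ 2) s
  let v23v24 := w.w24 * v24b4
  let v23v23 := v23b3 + v23v24
  let v13v24 := w.w14 * v24b4
  let v13v23 := v23v23
  match e with
  | .black24_b4 => v24b4
  | .white23_b3 => v23b3
  | .white23_black24 => v23v24
  | .black23_white23 => v23v23
  | .white13_black24 => v13v24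
  | .white13_black23 => v13v23
  | .b2_black23 => w.w23 * v23v23
  | .b1_white13 => w.w13 * (v13v23 + v13v24)

/-- The dressed edge wavefunction `Ψ_e = 𝔇 Φ_e`. -/
def dressedWave (w : Weights) (e : Edge) : Time → ℝ := darboux κ A (vacuumWave κ w e)

/-! ### The reducible curve and its ovals -/

/-- The rational components of the curve. -/
inductive Comp
  | gamma0
  | gamma13
  | gamma23
  | sigma23
  | sigma24

/-- Points of the normalization of the curve, which is a disjoint union of five copies of `ℂP¹`. A
point of the curve itself is such a point, with the two points of each double point identified. -/
abbrev Point := Comp × OnePoint ℂ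

/-- The essential singularity `P₀`. -/
def P0 : Point := (.gamma0, ∞)

/-- The real affine point with coordinate `x`. -/
def rpt (x : ℝ) : OnePoint ℂ := ((x : ℂ) : OnePoint ℂ)

/-- The double points of the curve, one for each edge of the network. On `Γ₁₃` and `Γ₂₃`, at a white
vertex, the coordinate is `∞` at the incoming edge and `0`, `1` at the two outgoing ones. On `Σ₂₃`
and `Σ₂₄` only the double points matter, and any real coordinate would do. -/
def node : Edge → Point × Point
  | .b1_white13 => ((.gamma0, rpt (κ 0)), (.gamma13, ∞))
  | .b2_black23 => ((.gamma0, rpt (κ 1)), (.sigma23, ∞))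
  | .white23_b3 => ((.gamma0, rpt (κ 2)), (.gamma23, rpt 1))
  | .black24_b4 => ((.gamma0, rpt (κ 3)), (.sigma24, ∞))
  | .white13_black23 => ((.gamma13, rpt 1), (.sigma23, rpt 0))
  | .white13_black24 => ((.gamma13, rpt 0), (.sigma24, rpt 0))
  | .black23_white23 => ((.gamma23, ∞), (.sigma23, rpt 1))
  | .white23_black24 => ((.gamma23, rpt 0), (.sigma24, rpt 1))

/-- The four finite ovals, one for each face of the network that does not touch the boundary arc
from `b₄` to `b₁`. The ovals `0, 1, 2` are those through `[κ₁, κ₂]`, `[κ₂, κ₃]`, `[κ₃, κ₄]` on `Γ₀`,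
and the oval `3` is the face bounded by the four internal vertices. Each oval is a union of closed
real arcs, which join consecutive real double points on a component. -/
def finiteOval : Fin 4 → Set Point
  | 0 => {Comp.gamma0} ×ˢ (rpt '' Set.Icc (κ 0) (κ 1)) ∪
      {Comp.gamma13} ×ˢ insert ∞ (rpt '' Set.Ici 1) ∪
      {Comp.sigma23} ×ˢ insert ∞ (rpt '' Set.Iic 0)
  | 1 => {Comp.gamma0} ×ˢ (rpt '' Set.Icc (κ 1) (κ 2)) ∪
      {Comp.gamma23} ×ˢ insert ∞ (rpt '' Set.Ici 1) ∪
      {Comp.sigma23} ×ˢ insert ∞ (rpt '' Set.Ici 1)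
  | 2 => {Comp.gamma0} ×ˢ (rpt '' Set.Icc (κ 2) (κ 3)) ∪
      {Comp.gamma23} ×ˢ (rpt '' Set.Icc 0 1) ∪
      {Comp.sigma24} ×ˢ insert ∞ (rpt '' Set.Ici 1)
  | 3 => {Comp.gamma13} ×ˢ (rpt '' Set.Icc 0 1) ∪
      {Comp.gamma23} ×ˢ insert ∞ (rpt '' Set.Iic 0) ∪
      {Comp.sigma23} ×ˢ (rpt '' Set.Icc 0 1) ∪
      {Comp.sigma24} ×ˢ (rpt '' Set.Icc 0 1)

/-- The infinite oval, i.e. the real oval that contains `P₀`. -/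
def infiniteOval : Set Point :=
  {Comp.gamma0} ×ˢ insert ∞ (rpt '' (Set.Iic (κ 0) ∪ Set.Ici (κ 3))) ∪
    {Comp.gamma13} ×ˢ insert ∞ (rpt '' Set.Iic 0) ∪
    {Comp.sigma24} ×ˢ insert ∞ (rpt '' Set.Iic 0)

/-! ### The KP wavefunction and its pole divisor -/

/-- Constant functions with a finite value. -/
def IsFiniteConstant (g : OnePoint ℂ → OnePoint ℂ) : Prop :=
  ∃ c : ℂ, ∀ z, g z = (c : OnePoint ℂ)

/-- Meromorphic functions of degree at most one on `ℂP¹`: constants and Möbius transformations. -/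
def IsMeromorphicDegLeOne (g : OnePoint ℂ → OnePoint ℂ) : Prop :=
  IsFiniteConstant g ∨ ∃ m : Matrix.GeneralLinearGroup (Fin 2) ℂ, ∀ z, g z = m • z

/-- A family of functions on the components of the curve, with values in `ℂ ∪ {∞}`. -/
abbrev Wave := Time → Comp → OnePoint ℂ → OnePoint ℂ

/-- The normalized KP wavefunction with initial time `s₀`: on `Γ₀` it is the Sato wavefunction
divided by its value at `s₀`, it is constant on the components of black vertices, of degree at most
one on those of white vertices, and it takes equal values at the two points of each double point. -/
structure IsKPWave (s₀ : Time) (ψ : Wave) : Prop where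
  sato : ∀ (s : Time) (z : ℂ), satoWave κ A z s₀ ≠ 0 →
    ψ s .gamma0 (z : OnePoint ℂ) = ((satoWave κ A z s / satoWave κ A z s₀ : ℂ) : OnePoint ℂ)
  sato_continuous : ∀ s : Time, Continuous fun z : ℂ => ψ s .gamma0 (z : OnePoint ℂ)
  black23 : ∀ s : Time, IsFiniteConstant (ψ s .sigma23)
  black24 : ∀ s : Time, IsFiniteConstant (ψ s .sigma24)
  white13 : ∀ s : Time, IsMeromorphicDegLeOne (ψ s .gamma13)
  white23 : ∀ s : Time, IsMeromorphicDegLeOne (ψ s .gamma23)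
  glue : ∀ (s : Time) (e : Edge),
    ψ s (node κ e).1.1 (node κ e).1.2 = ψ s (node κ e).2.1 (node κ e).2.2

/-- The finite values, with the irrelevant value `0` at `∞`. -/
def finitePart (x : OnePoint ℂ) : ℂ := x.elim 0 id

/-- A local parametrization of `ℂP¹` that sends `0` to the given point. -/
def localChart (p : OnePoint ℂ) (u : ℂ) : OnePoint ℂ :=
  p.elim (if u = 0 then ∞ else ((u⁻¹ : ℂ) : OnePoint ℂ)) fun z => ((z + u : ℂ) : OnePoint ℂ)

/-- The order at `p` of a meromorphic function (positive at zeros, negative at poles). -/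
def orderAt (g : OnePoint ℂ → OnePoint ℂ) (p : OnePoint ℂ) : WithTop ℤ :=
  meromorphicOrderAt (fun u : ℂ => finitePart (g (localChart p u))) 0

open Classical in
/-- The effective divisors `D` on the curve without `P₀` with `(ψ(s)) + D ≥ 0` for all times. -/
def dominatingDivisors (ψ : Wave) : Set (Multiset Point) :=
  {D | P0 ∉ D ∧ ∀ (s : Time) (p : Point), p ≠ P0 →
    0 ≤ orderAt (ψ s p.1) p.2 + ((D.count p : ℤ) : WithTop ℤ)}

/-- `D` is the pole divisor of `ψ`: the least effective divisor with `(ψ(s)) + D ≥ 0` for all `s`. -/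
def IsPoleDivisor (ψ : Wave) (D : Multiset Point) : Prop := IsLeast (dominatingDivisors ψ) D

/-! ### The dressed divisor, for all initial times -/

/-- The characteristic polynomial `ζ² - 𝔴₁(s₀) ζ - 𝔴₂(s₀)`; its roots form the Sato divisor. -/
def satoPoly (s₀ : Time) : Polynomial ℂ :=
  Polynomial.X ^ 2 - Polynomial.C (coeff1 κ A s₀ : ℂ) * Polynomial.X -
    Polynomial.C (coeff2 κ A s₀ : ℂ)

/-- The dressed divisor number at a white vertex, where `a` and `b` are the values at `s₀` of the
dressed edge wavefunction on the outgoing edges with coordinates `0` and `1`: the point with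
coordinate `a / (a + b)`, which is `∞` if `a + b = 0`. -/
def divisorNumber (a b : ℝ) : OnePoint ℂ := if a + b = 0 then ∞ else rpt (a / (a + b))

/-- The dressed divisor with initial time `s₀`: the Sato divisor on `Γ₀`, together with one point on
the component of each trivalent white vertex, given by the dressed divisor number. -/
def kpDivisor (w : Weights) (s₀ : Time) : Multiset Point :=
  (satoPoly κ A s₀).roots.map (fun z => ((Comp.gamma0, (z : OnePoint ℂ)) : Point)) +
    {(Comp.gamma13, divisorNumber (dressedWave κ A w .white13_black24 s₀)
        (dressedWave κ A w .white13_black23 s₀)),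
      (Comp.gamma23, divisorNumber (dressedWave κ A w .white23_black24 s₀)
        (dressedWave κ A w .white23_b3 s₀))}

/-- Generic data: all the denominators `𝔇 exp(θ_l(s₀))` are nonzero. -/
def IsGeneric (s₀ : Time) : Prop := ∀ l, dressedPhase κ A l s₀ ≠ 0

end KPGr24

end

open KPGr24
open scoped OnePoint

namespace KPGr24

/-! ### Derivatives and the dressing operator on sums of exponentials -/

/-! Write D_l for `dressedPhase κ A l`, l = 0, 1, 2, 3. Expanding the Wronskian of the two heat
solutions and exp θ(z) by Cauchy–Binet (`tau_mul_symbol`) presents τ times the symbol z² - 𝔴₁z - 𝔴₂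
as a sum over i < j of positive multiples of (z - κ i)(z - κ j). Hence the symbol is positive
outside the open interval (κ 0, κ 3), and D_0, D_3 > 0.

Since 𝔇 kills both heat solutions, row reduction gives D_0 = w13 (D_2 + (w14 + w24) D_3) and D_1 =
-w23 (D_2 + w24 D_3) (`Weights.Represents.dressedPhase_relations`). So D_1 ≥ 0 forces D_2 < 0, and
only five sign patterns remain, three of them generic. These signs decide everything: the symbol is
negative at κ 1 or at κ 2, which gives two distinct real roots and locates them among the phases;
the two divisor numbers are quotients built from D_2 and D_3, and their positions relative to 0, 1,
∞ follow from the signs of D_1 and D_2 (`divisor_configurations`).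

The same relations make each dressed edge wavefunction a constant multiple of a single D_l
(`dressedWave_ratio`), so the normalized values agree around each black vertex. On a white component
a function of degree at most one is fixed by its three nodal values; it is ((a + b)z - a)/((a₀ +
b₀)z - a₀), with its only possible pole at the divisor number a₀/(a₀ + b₀). All poles are simple and
at distinct points, so leastness of the divisor only needs, for each point, a time at which the
numerator does not cancel the pole (`isPoleDivisor_of_simple`); such times exist because all three
generic sign patterns occur. -/

theorem expPhase_pos (k : ℝ) (s : Time) : 0 < expPhase k s := Real.exp_pos _

theorem hasDerivAt_expPhase (k : ℝ) (s : Time) :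
    HasDerivAt (fun x => expPhase k (x, s.2)) (k * expPhase k s) s.1 := by
  have h : HasDerivAt (fun x : ℝ => k * x + k ^ 2 * s.2.1 + k ^ 3 * s.2.2) k s.1 := by
    simpa using (((hasDerivAt_id s.1).const_mul k).add_const (k ^ 2 * s.2.1)).add_const
      (k ^ 3 * s.2.2)
  simpa [expPhase, mul_comm] using h.exp

theorem dx_expPhase (k : ℝ) : dx (expPhase k) = fun s => k * expPhase k s :=
  funext fun s => (hasDerivAt_expPhase k s).deriv

theorem dx_expSum (κ c : Fin 4 → ℝ) :
    dx (fun s => ∑ j, c j * expPhase (κ j) s) =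
      fun s => ∑ j, (c j * κ j) * expPhase (κ j) s := by
  funext s
  have h : HasDerivAt (fun x => ∑ j, c j * expPhase (κ j) (x, s.2))
      (∑ j, c j * (κ j * expPhase (κ j) s)) s.1 :=
    HasDerivAt.fun_sum fun j _ => (hasDerivAt_expPhase (κ j) s).const_mul (c j)
  exact h.deriv.trans (Finset.sum_congr rfl fun j _ => by ring)

theorem expTheta_ne_zero (z : ℂ) (s : Time) : expTheta z s ≠ 0 := Complex.exp_ne_zero _

theorem expTheta_ofReal (k : ℝ) (s : Time) : expTheta k s = (expPhase k s : ℝ) := by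
  simp [expTheta, expPhase]

theorem hasDerivAt_expTheta (z : ℂ) (s : Time) :
    HasDerivAt (fun x : ℝ => expTheta z (x, s.2)) (z * expTheta z s) s.1 := by
  have h : HasDerivAt (fun x : ℝ => z * (x : ℂ) + z ^ 2 * (s.2.1 : ℂ) + z ^ 3 * (s.2.2 : ℂ))
      z s.1 := by
    simpa using (((Complex.ofRealCLM.hasDerivAt (x := s.1)).const_mul z).add_const
      (z ^ 2 * (s.2.1 : ℂ))).add_const (z ^ 3 * (s.2.2 : ℂ))
  simpa [expTheta, mul_comm] using h.cexp

theorem dx_expTheta (z : ℂ) : dx (expTheta z) = fun s => z * expTheta z s :=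
  funext fun s => (hasDerivAt_expTheta z s).deriv

theorem dx_dx_expTheta (z : ℂ) : dx (dx (expTheta z)) = fun s => z ^ 2 * expTheta z s := by
  funext s
  rw [dx_expTheta, pow_two, mul_assoc]
  exact ((hasDerivAt_expTheta z s).const_mul z).deriv

section Dressing

variable (κ : Fin 4 → ℝ) (A : Matrix (Fin 2) (Fin 4) ℝ)

theorem dressedPhase_eq (l : Fin 4) (s : Time) :
    dressedPhase κ A l s =
      (κ l ^ 2 - coeff1 κ A s * κ l - coeff2 κ A s) * expPhase (κ l) s := by
  have h : dx (fun s => κ l * expPhase (κ l) s) = fun s => κ l ^ 2 * expPhase (κ l) s := by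
    funext s
    rw [pow_two, mul_assoc]
    exact ((hasDerivAt_expPhase (κ l) s).const_mul (κ l)).deriv
  simp only [dressedPhase, darboux, dx_expPhase, h, smul_eq_mul]
  ring

theorem satoWave_eq (z : ℂ) (s : Time) :
    satoWave κ A z s = (z ^ 2 - coeff1 κ A s * z - coeff2 κ A s) * expTheta z s := by
  rw [satoWave, darboux, dx_dx_expTheta, dx_expTheta, Complex.real_smul, Complex.real_smul]
  ring

theorem satoWave_ofReal (l : Fin 4) (s : Time) :
    satoWave κ A (κ l) s = (dressedPhase κ A l s : ℝ) := by
  rw [satoWave_eq, dressedPhase_eq, expTheta_ofReal]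
  push_cast
  ring

/-- The coefficients of 𝔇 depend on time, but 𝔇 is linear over the constants `c j`. Heat solutions
and vacuum edge wavefunctions are both sums of this kind. -/
theorem darboux_expSum (c : Fin 4 → ℝ) (s : Time) :
    darboux κ A (fun s => ∑ j, c j * expPhase (κ j) s) s =
      ∑ j, c j * dressedPhase κ A j s := by
  simp only [darboux, dx_expSum, dressedPhase_eq, smul_eq_mul, Finset.mul_sum,
    ← Finset.sum_sub_distrib]
  exact Finset.sum_congr rfl fun j _ => by ring

/-- The maximal minors of a `2 × 4` matrix. -/
def minor (A : Matrix (Fin 2) (Fin 4) ℝ) (i j : Fin 4) : ℝ := A 0 i * A 1 j - A 0 j * A 1 i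

theorem dx_heatSol (i : Fin 2) :
    dx (heatSol κ A i) = fun s => ∑ j, (A i j * κ j) * expPhase (κ j) s :=
  dx_expSum κ (A i)

theorem dx_dx_heatSol (i : Fin 2) :
    dx (dx (heatSol κ A i)) = fun s => ∑ j, (A i j * κ j * κ j) * expPhase (κ j) s := by
  rw [dx_heatSol, dx_expSum]

theorem tau_eq (s : Time) :
    tau κ A s =
      minor A 0 1 * (κ 1 - κ 0) * (expPhase (κ 0) s * expPhase (κ 1) s) +
      minor A 0 2 * (κ 2 - κ 0) * (expPhase (κ 0) s * expPhase (κ 2) s) +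
      minor A 0 3 * (κ 3 - κ 0) * (expPhase (κ 0) s * expPhase (κ 3) s) +
      minor A 1 2 * (κ 2 - κ 1) * (expPhase (κ 1) s * expPhase (κ 2) s) +
      minor A 1 3 * (κ 3 - κ 1) * (expPhase (κ 1) s * expPhase (κ 3) s) +
      minor A 2 3 * (κ 3 - κ 2) * (expPhase (κ 2) s * expPhase (κ 3) s) := by
  simp only [tau, dx_heatSol, heatSol, Fin.sum_univ_four, minor]
  ring

variable {κ A}

theorem tau_pos (hκ : StrictMono κ) (hA : IsTotallyPositive A) (s : Time) : 0 < tau κ A s := by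
  have hm : ∀ i j : Fin 4, i < j →
      0 < minor A i j * (κ j - κ i) * (expPhase (κ i) s * expPhase (κ j) s) := fun i j h =>
    mul_pos (mul_pos (hA i j h) (sub_pos.2 (hκ h))) (mul_pos (expPhase_pos _ _) (expPhase_pos _ _))
  rw [tau_eq]
  linarith [hm 0 1 (by decide), hm 0 2 (by decide), hm 0 3 (by decide), hm 1 2 (by decide),
    hm 1 3 (by decide), hm 2 3 (by decide)]

/-- By Cramer's rule, τ times 𝔇 exp θ(z) is the 3 × 3 Wronskian of the heat solutions and exp θ(z).
Cauchy–Binet turns it into minors times the Vandermonde factors (κ j - κ i)(z - κ i)(z - κ j). -/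
theorem tau_mul_symbol (hκ : StrictMono κ) (hA : IsTotallyPositive A) (s : Time) (z : ℝ) :
    tau κ A s * (z ^ 2 - coeff1 κ A s * z - coeff2 κ A s) =
      minor A 0 1 * (κ 1 - κ 0) * ((z - κ 0) * (z - κ 1)) *
        (expPhase (κ 0) s * expPhase (κ 1) s) +
      minor A 0 2 * (κ 2 - κ 0) * ((z - κ 0) * (z - κ 2)) *
        (expPhase (κ 0) s * expPhase (κ 2) s) +
      minor A 0 3 * (κ 3 - κ 0) * ((z - κ 0) * (z - κ 3)) *
        (expPhase (κ 0) s * expPhase (κ 3) s) +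
      minor A 1 2 * (κ 2 - κ 1) * ((z - κ 1) * (z - κ 2)) *
        (expPhase (κ 1) s * expPhase (κ 2) s) +
      minor A 1 3 * (κ 3 - κ 1) * ((z - κ 1) * (z - κ 3)) *
        (expPhase (κ 1) s * expPhase (κ 3) s) +
      minor A 2 3 * (κ 3 - κ 2) * ((z - κ 2) * (z - κ 3)) *
        (expPhase (κ 2) s * expPhase (κ 3) s) := by
  have h0 := (tau_pos hκ hA s).ne'
  have e1 : tau κ A s * coeff1 κ A s = _ := mul_div_cancel₀ _ h0
  have e2 : tau κ A s * coeff2 κ A s = _ := mul_div_cancel₀ _ h0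
  have : tau κ A s * (z ^ 2 - coeff1 κ A s * z - coeff2 κ A s) =
      tau κ A s * z ^ 2 - tau κ A s * coeff1 κ A s * z - tau κ A s * coeff2 κ A s := by ring
  rw [this, e1, e2, tau_eq, dx_dx_heatSol, dx_dx_heatSol]
  simp only [dx_heatSol, heatSol, Fin.sum_univ_four, minor]
  ring

/-- τ is, up to sign, the determinant of this linear system for (a, b), and it never vanishes, so
Cramer's rule gives an equivalence. -/
theorem darboux_coeff_unique (hκ : StrictMono κ) (hA : IsTotallyPositive A) (s : Time)
    (a b : ℝ) :
    (∀ i, dx (dx (heatSol κ A i)) s = a * dx (heatSol κ A i) s + b * heatSol κ A i s) ↔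
      a = coeff1 κ A s ∧ b = coeff2 κ A s := by
  have h0 := (tau_pos hκ hA s).ne'
  rw [Fin.forall_fin_two, coeff1, coeff2, eq_div_iff h0, eq_div_iff h0]
  constructor
  · rintro ⟨h1, h2⟩
    rw [h1, h2, tau]
    constructor <;> ring
  · rintro ⟨h1, h2⟩
    constructor <;> apply mul_left_cancel₀ h0 <;> rw [mul_add, ← mul_assoc, ← mul_assoc,
      mul_comm _ a, mul_comm _ b, h1, h2, tau] <;> ring

theorem darboux_heatSol (hκ : StrictMono κ) (hA : IsTotallyPositive A) (i : Fin 2) (s : Time) :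
    darboux κ A (heatSol κ A i) s = 0 := by
  have h := (darboux_coeff_unique hκ hA s _ _).2 ⟨rfl, rfl⟩ i
  rw [darboux, h, smul_eq_mul, smul_eq_mul]
  ring

/-- The two linear relations among the four dressed exponentials, from which the network relations
are extracted. -/
theorem sum_mul_dressedPhase (hκ : StrictMono κ) (hA : IsTotallyPositive A) (i : Fin 2)
    (s : Time) : ∑ j, A i j * dressedPhase κ A j s = 0 := by
  rw [← darboux_expSum]
  exact darboux_heatSol hκ hA i s

/-! ### Signs of the dressed exponentials -/

theorem tau_mul_dressedPhase (l : Fin 4) (s : Time) :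
    tau κ A s * dressedPhase κ A l s =
      tau κ A s * (κ l ^ 2 - coeff1 κ A s * κ l - coeff2 κ A s) * expPhase (κ l) s := by
  rw [dressedPhase_eq, mul_assoc]

theorem symbol_pos_of_le (hκ : StrictMono κ) (hA : IsTotallyPositive A) (s : Time) {z : ℝ}
    (hz : z ≤ κ 0) : 0 < z ^ 2 - coeff1 κ A s * z - coeff2 κ A s := by
  have h01 : κ 0 < κ 1 := hκ (by decide)
  have h12 : κ 1 < κ 2 := hκ (by decide)
  have h23 : κ 2 < κ 3 := hκ (by decide)
  have hm : ∀ i j : Fin 4, i < j → 0 ≤ (z - κ i) * (z - κ j) →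
      0 ≤ minor A i j * (κ j - κ i) * ((z - κ i) * (z - κ j)) *
        (expPhase (κ i) s * expPhase (κ j) s) := fun i j h h' =>
    mul_nonneg (mul_nonneg (mul_pos (hA i j h) (sub_pos.2 (hκ h))).le h')
      (mul_pos (expPhase_pos _ _) (expPhase_pos _ _)).le
  have h0 : ∀ i : Fin 4, z - κ i ≤ 0 := fun i =>
    sub_nonpos.2 (hz.trans (hκ.monotone (Fin.zero_le i)))
  have hn : ∀ i j : Fin 4, 0 ≤ (z - κ i) * (z - κ j) := fun i j =>
    mul_nonneg_of_nonpos_of_nonpos (h0 i) (h0 j)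
  -- The pair (1, 2) avoids both end phases, so its term stays strictly positive even at z = κ 0.
  have hp : 0 < minor A 1 2 * (κ 2 - κ 1) * ((z - κ 1) * (z - κ 2)) *
      (expPhase (κ 1) s * expPhase (κ 2) s) :=
    mul_pos (mul_pos (mul_pos (hA 1 2 (by decide)) (by linarith))
      (mul_pos_of_neg_of_neg (by linarith) (by linarith)))
      (mul_pos (expPhase_pos _ _) (expPhase_pos _ _))
  refine pos_of_mul_pos_right (a := tau κ A s) ?_ (tau_pos hκ hA s).le
  rw [tau_mul_symbol hκ hA]
  linarith [hm 0 1 (by decide) (hn _ _), hm 0 2 (by decide) (hn _ _),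
    hm 0 3 (by decide) (hn _ _), hm 1 3 (by decide) (hn _ _), hm 2 3 (by decide) (hn _ _)]

theorem symbol_pos_of_ge (hκ : StrictMono κ) (hA : IsTotallyPositive A) (s : Time) {z : ℝ}
    (hz : κ 3 ≤ z) : 0 < z ^ 2 - coeff1 κ A s * z - coeff2 κ A s := by
  have h01 : κ 0 < κ 1 := hκ (by decide)
  have h12 : κ 1 < κ 2 := hκ (by decide)
  have h23 : κ 2 < κ 3 := hκ (by decide)
  have hm : ∀ i j : Fin 4, i < j → 0 ≤ (z - κ i) * (z - κ j) →
      0 ≤ minor A i j * (κ j - κ i) * ((z - κ i) * (z - κ j)) *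
        (expPhase (κ i) s * expPhase (κ j) s) := fun i j h h' =>
    mul_nonneg (mul_nonneg (mul_pos (hA i j h) (sub_pos.2 (hκ h))).le h')
      (mul_pos (expPhase_pos _ _) (expPhase_pos _ _)).le
  have h0 : ∀ i : Fin 4, 0 ≤ z - κ i := fun i =>
    sub_nonneg.2 ((hκ.monotone (Fin.le_last i)).trans hz)
  have hn : ∀ i j : Fin 4, 0 ≤ (z - κ i) * (z - κ j) := fun i j => mul_nonneg (h0 i) (h0 j)
  have hp : 0 < minor A 1 2 * (κ 2 - κ 1) * ((z - κ 1) * (z - κ 2)) *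
      (expPhase (κ 1) s * expPhase (κ 2) s) :=
    mul_pos (mul_pos (mul_pos (hA 1 2 (by decide)) (by linarith))
      (mul_pos (by linarith) (by linarith)))
      (mul_pos (expPhase_pos _ _) (expPhase_pos _ _))
  refine pos_of_mul_pos_right (a := tau κ A s) ?_ (tau_pos hκ hA s).le
  rw [tau_mul_symbol hκ hA]
  linarith [hm 0 1 (by decide) (hn _ _), hm 0 2 (by decide) (hn _ _),
    hm 0 3 (by decide) (hn _ _), hm 1 3 (by decide) (hn _ _), hm 2 3 (by decide) (hn _ _)]

theorem dressedPhase_zero_pos (hκ : StrictMono κ) (hA : IsTotallyPositive A) (s : Time) :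
    0 < dressedPhase κ A 0 s := by
  rw [dressedPhase_eq]
  exact mul_pos (symbol_pos_of_le hκ hA s le_rfl) (expPhase_pos _ _)

theorem dressedPhase_three_pos (hκ : StrictMono κ) (hA : IsTotallyPositive A) (s : Time) :
    0 < dressedPhase κ A 3 s := by
  rw [dressedPhase_eq]
  exact mul_pos (symbol_pos_of_ge hκ hA s le_rfl) (expPhase_pos _ _)

/-- Up to a positive factor, the dressed exponential for `κ 1` is strictly increasing in `x`. -/
theorem exists_dressedPhase_one_eq (hκ : StrictMono κ) (hA : IsTotallyPositive A) :
    ∃ a b c : ℝ, 0 < a ∧ 0 < b ∧ 0 < c ∧ ∀ s, ∃ m : ℝ, 0 < m ∧ dressedPhase κ A 1 s =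
      m * (c - a * (expPhase (κ 0) s / expPhase (κ 2) s) -
        b * (expPhase (κ 0) s / expPhase (κ 3) s)) := by
  have h01 : κ 0 < κ 1 := hκ (by decide)
  have h12 : κ 1 < κ 2 := hκ (by decide)
  have h23 : κ 2 < κ 3 := hκ (by decide)
  -- At z = κ 1 only the pairs without index 1 survive in `tau_mul_symbol`: (2, 3) contributes
  -- positively, (0, 2) and (0, 3) negatively. Factoring out the exponentials of the pair (2, 3)
  -- leaves the constant `c` and two ratios.
  refine ⟨minor A 0 3 * (κ 3 - κ 0) * ((κ 1 - κ 0) * (κ 3 - κ 1)),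
    minor A 0 2 * (κ 2 - κ 0) * ((κ 1 - κ 0) * (κ 2 - κ 1)),
    minor A 2 3 * (κ 3 - κ 2) * ((κ 2 - κ 1) * (κ 3 - κ 1)),
    mul_pos (mul_pos (hA 0 3 (by decide)) (by linarith)) (mul_pos (by linarith) (by linarith)),
    mul_pos (mul_pos (hA 0 2 (by decide)) (by linarith)) (mul_pos (by linarith) (by linarith)),
    mul_pos (mul_pos (hA 2 3 (by decide)) (by linarith)) (mul_pos (by linarith) (by linarith)),
    fun s => ⟨expPhase (κ 1) s * expPhase (κ 2) s * expPhase (κ 3) s / tau κ A s, ?_, ?_⟩⟩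
  · exact div_pos (mul_pos (mul_pos (expPhase_pos _ _) (expPhase_pos _ _)) (expPhase_pos _ _))
      (tau_pos hκ hA s)
  · have ht := (tau_pos hκ hA s).ne'
    have h2 := (expPhase_pos (κ 2) s).ne'
    have h3 := (expPhase_pos (κ 3) s).ne'
    apply mul_left_cancel₀ ht
    rw [tau_mul_dressedPhase, tau_mul_symbol hκ hA]
    field_simp
    ring

/-- Up to a positive factor, the dressed exponential for `κ 2` is strictly decreasing in `x`. -/
theorem exists_dressedPhase_two_eq (hκ : StrictMono κ) (hA : IsTotallyPositive A) :
    ∃ a b c : ℝ, 0 < a ∧ 0 < b ∧ 0 < c ∧ ∀ s, ∃ m : ℝ, 0 < m ∧ dressedPhase κ A 2 s =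
      m * (c - a * (expPhase (κ 3) s / expPhase (κ 1) s) -
        b * (expPhase (κ 3) s / expPhase (κ 0) s)) := by
  have h01 : κ 0 < κ 1 := hκ (by decide)
  have h12 : κ 1 < κ 2 := hκ (by decide)
  have h23 : κ 2 < κ 3 := hκ (by decide)
  refine ⟨minor A 0 3 * (κ 3 - κ 0) * ((κ 2 - κ 0) * (κ 3 - κ 2)),
    minor A 1 3 * (κ 3 - κ 1) * ((κ 2 - κ 1) * (κ 3 - κ 2)),
    minor A 0 1 * (κ 1 - κ 0) * ((κ 2 - κ 0) * (κ 2 - κ 1)),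
    mul_pos (mul_pos (hA 0 3 (by decide)) (by linarith)) (mul_pos (by linarith) (by linarith)),
    mul_pos (mul_pos (hA 1 3 (by decide)) (by linarith)) (mul_pos (by linarith) (by linarith)),
    mul_pos (mul_pos (hA 0 1 (by decide)) (by linarith)) (mul_pos (by linarith) (by linarith)),
    fun s => ⟨expPhase (κ 2) s * expPhase (κ 0) s * expPhase (κ 1) s / tau κ A s, ?_, ?_⟩⟩
  · exact div_pos (mul_pos (mul_pos (expPhase_pos _ _) (expPhase_pos _ _)) (expPhase_pos _ _))
      (tau_pos hκ hA s)
  · have ht := (tau_pos hκ hA s).ne'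
    have h0 := (expPhase_pos (κ 0) s).ne'
    have h1 := (expPhase_pos (κ 1) s).ne'
    apply mul_left_cancel₀ ht
    rw [tau_mul_dressedPhase, tau_mul_symbol hκ hA]
    field_simp
    ring

end Dressing

/-! ### Sign patterns and generic times -/

theorem expPhase_div (k l : ℝ) (s : Time) : expPhase k s / expPhase l s =
    Real.exp ((k - l) * s.1 + (k ^ 2 - l ^ 2) * s.2.1 + (k ^ 3 - l ^ 3) * s.2.2) := by
  rw [expPhase, expPhase, ← Real.exp_sub]
  congr 1
  ring

theorem continuous_expPhase_div (k l : ℝ) :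
    Continuous fun s : Time => expPhase k s / expPhase l s := by
  simp only [expPhase_div]
  fun_prop

theorem expPhase_div_lt {k l x x' : ℝ} (h : (k - l) * x < (k - l) * x') (p : ℝ × ℝ) :
    expPhase k (x, p) / expPhase l (x, p) < expPhase k (x', p) / expPhase l (x', p) := by
  simp only [expPhase_div, Real.exp_lt_exp]
  linarith

theorem tendsto_expPhase_div_atBot {k l : ℝ} (h : k < l) :
    Filter.Tendsto (fun x : ℝ => expPhase k (x, 0) / expPhase l (x, 0)) Filter.atBot
      Filter.atTop := by
  simp only [expPhase_div, Prod.fst_zero, Prod.snd_zero, mul_zero, add_zero]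
  exact Real.tendsto_exp_atTop.comp
    (Filter.Tendsto.const_mul_atBot_of_neg (sub_neg.2 h) Filter.tendsto_id)

theorem tendsto_expPhase_div_atTop {k l : ℝ} (h : k < l) :
    Filter.Tendsto (fun x : ℝ => expPhase k (x, 0) / expPhase l (x, 0)) Filter.atTop
      (𝓝 0) := by
  simp only [expPhase_div, Prod.fst_zero, Prod.snd_zero, mul_zero, add_zero]
  exact Real.tendsto_exp_atBot.comp
    (Filter.Tendsto.const_mul_atTop_of_neg (sub_neg.2 h) Filter.tendsto_id)

theorem tendsto_expPhase_div_atTop' {k l : ℝ} (h : l < k) :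
    Filter.Tendsto (fun x : ℝ => expPhase k (x, 0) / expPhase l (x, 0)) Filter.atTop
      Filter.atTop := by
  simp only [expPhase_div, Prod.fst_zero, Prod.snd_zero, mul_zero, add_zero]
  exact Real.tendsto_exp_atTop.comp
    (Filter.Tendsto.const_mul_atTop (sub_pos.2 h) Filter.tendsto_id)

theorem tendsto_expPhase_div_atBot' {k l : ℝ} (h : l < k) :
    Filter.Tendsto (fun x : ℝ => expPhase k (x, 0) / expPhase l (x, 0)) Filter.atBot
      (𝓝 0) := by
  simp only [expPhase_div, Prod.fst_zero, Prod.snd_zero, mul_zero, add_zero]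
  exact Real.tendsto_exp_atBot.comp
    (Filter.Tendsto.const_mul_atBot (sub_pos.2 h) Filter.tendsto_id)

section Signs

variable {κ : Fin 4 → ℝ} {A : Matrix (Fin 2) (Fin 4) ℝ}

/-- Let x → -∞ with y = t = 0: the ratios of a smaller to a larger phase blow up and the opposite
ones vanish. The pattern with both signs reversed comes from x → +∞. -/
theorem exists_one_neg_two_pos (hκ : StrictMono κ) (hA : IsTotallyPositive A) :
    ∃ s, dressedPhase κ A 1 s < 0 ∧ 0 < dressedPhase κ A 2 s := by
  obtain ⟨a, b, c, ha, hb, hc, h1⟩ := exists_dressedPhase_one_eq hκ hA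
  obtain ⟨a', b', c', ha', hb', hc', h2⟩ := exists_dressedPhase_two_eq hκ hA
  have e1 := (tendsto_expPhase_div_atBot (hκ (show (0 : Fin 4) < 2 by decide))).eventually_gt_atTop
    (c / a)
  have e2 : ∀ᶠ x in Filter.atBot, a' * (expPhase (κ 3) (x, 0) / expPhase (κ 1) (x, 0)) +
      b' * (expPhase (κ 3) (x, 0) / expPhase (κ 0) (x, 0)) < c' := by
    have t := ((tendsto_expPhase_div_atBot' (hκ (show (1 : Fin 4) < 3 by decide))).const_mul
      a').add ((tendsto_expPhase_div_atBot' (hκ (show (0 : Fin 4) < 3 by decide))).const_mul b')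
    rw [mul_zero, mul_zero, add_zero] at t
    exact t.eventually_lt_const hc'
  obtain ⟨x, hx1, hx2⟩ := (e1.and e2).exists
  obtain ⟨m, hm, h1⟩ := h1 (x, 0)
  obtain ⟨m', hm', h2⟩ := h2 (x, 0)
  rw [div_lt_iff₀' ha] at hx1
  have := mul_pos hb (div_pos (expPhase_pos (κ 0) (x, 0)) (expPhase_pos (κ 3) (x, 0)))
  refine ⟨(x, 0), ?_, ?_⟩
  · rw [h1]; exact mul_neg_of_pos_of_neg hm (by linarith)
  · rw [h2]; exact mul_pos hm' (by linarith)

theorem exists_one_pos_two_neg (hκ : StrictMono κ) (hA : IsTotallyPositive A) :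
    ∃ s, 0 < dressedPhase κ A 1 s ∧ dressedPhase κ A 2 s < 0 := by
  obtain ⟨a, b, c, ha, hb, hc, h1⟩ := exists_dressedPhase_one_eq hκ hA
  obtain ⟨a', b', c', ha', hb', hc', h2⟩ := exists_dressedPhase_two_eq hκ hA
  have e1 := (tendsto_expPhase_div_atTop'
    (hκ (show (1 : Fin 4) < 3 by decide))).eventually_gt_atTop (c' / a')
  have e2 : ∀ᶠ x in Filter.atTop, a * (expPhase (κ 0) (x, 0) / expPhase (κ 2) (x, 0)) +
      b * (expPhase (κ 0) (x, 0) / expPhase (κ 3) (x, 0)) < c := by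
    have t := ((tendsto_expPhase_div_atTop (hκ (show (0 : Fin 4) < 2 by decide))).const_mul
      a).add ((tendsto_expPhase_div_atTop (hκ (show (0 : Fin 4) < 3 by decide))).const_mul b)
    rw [mul_zero, mul_zero, add_zero] at t
    exact t.eventually_lt_const hc
  obtain ⟨x, hx1, hx2⟩ := (e1.and e2).exists
  obtain ⟨m, hm, h1⟩ := h1 (x, 0)
  obtain ⟨m', hm', h2⟩ := h2 (x, 0)
  rw [div_lt_iff₀' ha'] at hx1
  have := mul_pos hb' (div_pos (expPhase_pos (κ 3) (x, 0)) (expPhase_pos (κ 0) (x, 0)))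
  refine ⟨(x, 0), ?_, ?_⟩
  · rw [h1]; exact mul_pos hm (by linarith)
  · rw [h2]; exact mul_neg_of_pos_of_neg hm' (by linarith)

/-- Moving x alone trades one ratio against the other. With y as a second parameter, the exponents
of E₀/E₂ and E₃/E₁ can be prescribed independently, so both ratios can be made large at once. -/
theorem exists_one_neg_two_neg (hκ : StrictMono κ) (hA : IsTotallyPositive A) :
    ∃ s, dressedPhase κ A 1 s < 0 ∧ dressedPhase κ A 2 s < 0 := by
  obtain ⟨a, b, c, ha, hb, hc, h1⟩ := exists_dressedPhase_one_eq hκ hA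
  obtain ⟨a', b', c', ha', hb', hc', h2⟩ := exists_dressedPhase_two_eq hκ hA
  have k02 : κ 0 - κ 2 < 0 := sub_neg.2 (hκ (by decide))
  have k13 : 0 < κ 3 - κ 1 := sub_pos.2 (hκ (by decide))
  have k01 : κ 0 < κ 1 := hκ (by decide)
  have k23 : κ 2 < κ 3 := hκ (by decide)
  obtain ⟨x, y, hx, hy⟩ : ∃ x y : ℝ,
      (κ 0 - κ 2) * x + (κ 0 ^ 2 - κ 2 ^ 2) * y = c / a + c' / a' ∧
      (κ 3 - κ 1) * x + (κ 3 ^ 2 - κ 1 ^ 2) * y = c / a + c' / a' := by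
    generalize c / a + c' / a' = M
    -- The determinant of the system in (x, y) is (κ 0 - κ 2)(κ 3 - κ 1) times this difference.
    have hd : (κ 3 + κ 1) - (κ 0 + κ 2) ≠ 0 := by linarith
    refine ⟨M / (κ 0 - κ 2) - (κ 0 + κ 2) *
      ((M / (κ 3 - κ 1) - M / (κ 0 - κ 2)) / ((κ 3 + κ 1) - (κ 0 + κ 2))),
      (M / (κ 3 - κ 1) - M / (κ 0 - κ 2)) / ((κ 3 + κ 1) - (κ 0 + κ 2)), ?_, ?_⟩
    · field_simp [k02.ne]
      ring
    · field_simp [k02.ne, k13.ne']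
      ring
  obtain ⟨m, hm, h1⟩ := h1 (x, y, 0)
  obtain ⟨m', hm', h2⟩ := h2 (x, y, 0)
  have e1 : c < a * (expPhase (κ 0) (x, y, 0) / expPhase (κ 2) (x, y, 0)) := by
    rw [← div_lt_iff₀' ha, expPhase_div, mul_zero, add_zero, hx]
    -- With M = c/a + c'/a', the bound exp M ≥ M + 1 exceeds both thresholds c/a and c'/a'.
    linarith [Real.add_one_le_exp (c / a + c' / a'), div_pos hc' ha']
  have e2 : c' < a' * (expPhase (κ 3) (x, y, 0) / expPhase (κ 1) (x, y, 0)) := by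
    rw [← div_lt_iff₀' ha', expPhase_div, mul_zero, add_zero, hy]
    linarith [Real.add_one_le_exp (c / a + c' / a'), div_pos hc ha]
  have := mul_pos hb (div_pos (expPhase_pos (κ 0) (x, y, 0)) (expPhase_pos (κ 3) (x, y, 0)))
  have := mul_pos hb' (div_pos (expPhase_pos (κ 3) (x, y, 0)) (expPhase_pos (κ 0) (x, y, 0)))
  refine ⟨(x, y, 0), ?_, ?_⟩
  · rw [h1]; exact mul_neg_of_pos_of_neg hm (by linarith)
  · rw [h2]; exact mul_neg_of_pos_of_neg hm' (by linarith)

theorem isGeneric_iff (hκ : StrictMono κ) (hA : IsTotallyPositive A) (s : Time) :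
    IsGeneric κ A s ↔ dressedPhase κ A 1 s ≠ 0 ∧ dressedPhase κ A 2 s ≠ 0 :=
  ⟨fun h => ⟨h 1, h 2⟩, fun h l => by
    fin_cases l
    exacts [(dressedPhase_zero_pos hκ hA s).ne', h.1, h.2, (dressedPhase_three_pos hκ hA s).ne']⟩

theorem isOpen_isGeneric (hκ : StrictMono κ) (hA : IsTotallyPositive A) :
    IsOpen {s | IsGeneric κ A s} := by
  obtain ⟨a, b, c, ha, hb, hc, h1⟩ := exists_dressedPhase_one_eq hκ hA
  obtain ⟨a', b', c', ha', hb', hc', h2⟩ := exists_dressedPhase_two_eq hκ hA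
  have key : {s | IsGeneric κ A s} =
      {s | c - a * (expPhase (κ 0) s / expPhase (κ 2) s) -
        b * (expPhase (κ 0) s / expPhase (κ 3) s) ≠ 0} ∩
      {s | c' - a' * (expPhase (κ 3) s / expPhase (κ 1) s) -
        b' * (expPhase (κ 3) s / expPhase (κ 0) s) ≠ 0} := by
    ext s
    obtain ⟨m, hm, h1⟩ := h1 s
    obtain ⟨m', hm', h2⟩ := h2 s
    simp only [Set.mem_ofPred_eq, Set.mem_inter_iff, isGeneric_iff hκ hA, h1, h2, ne_eq,
      mul_eq_zero, hm.ne', hm'.ne', false_or]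
  rw [key]
  refine IsOpen.inter (isOpen_ne_fun ?_ continuous_const) (isOpen_ne_fun ?_ continuous_const)
  · exact (continuous_const.sub ((continuous_expPhase_div _ _).const_mul a)).sub
      ((continuous_expPhase_div _ _).const_mul b)
  · exact (continuous_const.sub ((continuous_expPhase_div _ _).const_mul a')).sub
      ((continuous_expPhase_div _ _).const_mul b')

/-- On each line with y and t fixed, D_1 and D_2 are positive factors times strictly monotone
functions of x, so at most two points of the line are not generic. -/
theorem dense_isGeneric (hκ : StrictMono κ) (hA : IsTotallyPositive A) :
    Dense {s | IsGeneric κ A s} := by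
  obtain ⟨a, b, c, ha, hb, hc, h1⟩ := exists_dressedPhase_one_eq hκ hA
  obtain ⟨a', b', c', ha', hb', hc', h2⟩ := exists_dressedPhase_two_eq hκ hA
  have k02 : κ 0 - κ 2 < 0 := sub_neg.2 (hκ (by decide))
  have k03 : κ 0 - κ 3 < 0 := sub_neg.2 (hκ (by decide))
  have k13 : 0 < κ 3 - κ 1 := sub_pos.2 (hκ (by decide))
  have k30 : 0 < κ 3 - κ 0 := sub_pos.2 (hκ (by decide))
  rw [dense_iff_inter_open]
  rintro U hU ⟨⟨x₀, p⟩, hx₀⟩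
  have sub1 : {x : ℝ | dressedPhase κ A 1 (x, p) = 0}.Subsingleton := by
    have : ∀ x x' : ℝ, dressedPhase κ A 1 (x, p) = 0 → dressedPhase κ A 1 (x', p) = 0 →
        ¬ x < x' := by
      intro x x' h h' hlt
      obtain ⟨m, hm, e⟩ := h1 (x, p)
      obtain ⟨m', hm', e'⟩ := h1 (x', p)
      rw [e, mul_eq_zero_iff_left hm.ne'] at h
      rw [e', mul_eq_zero_iff_left hm'.ne'] at h'
      have l1 := mul_lt_mul_of_pos_left
        (expPhase_div_lt (mul_lt_mul_of_neg_left hlt k02) p) ha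
      have l2 := mul_lt_mul_of_pos_left
        (expPhase_div_lt (mul_lt_mul_of_neg_left hlt k03) p) hb
      linarith
    exact fun x h x' h' => le_antisymm (not_lt.1 (this _ _ h' h)) (not_lt.1 (this _ _ h h'))
  have sub2 : {x : ℝ | dressedPhase κ A 2 (x, p) = 0}.Subsingleton := by
    have : ∀ x x' : ℝ, dressedPhase κ A 2 (x, p) = 0 → dressedPhase κ A 2 (x', p) = 0 →
        ¬ x < x' := by
      intro x x' h h' hlt
      obtain ⟨m, hm, e⟩ := h2 (x, p)
      obtain ⟨m', hm', e'⟩ := h2 (x', p)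
      rw [e, mul_eq_zero_iff_left hm.ne'] at h
      rw [e', mul_eq_zero_iff_left hm'.ne'] at h'
      have l1 := mul_lt_mul_of_pos_left
        (expPhase_div_lt (mul_lt_mul_of_pos_left hlt k13) p) ha'
      have l2 := mul_lt_mul_of_pos_left
        (expPhase_div_lt (mul_lt_mul_of_pos_left hlt k30) p) hb'
      linarith
    exact fun x h x' h' => le_antisymm (not_lt.1 (this _ _ h' h)) (not_lt.1 (this _ _ h h'))
  have hV : (fun x : ℝ => (x, p)) ⁻¹' U ∈ 𝓝 x₀ :=
    (hU.preimage (by fun_prop : Continuous fun x : ℝ => (x, p))).mem_nhds hx₀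
  obtain ⟨x, hxU, hx⟩ := ((infinite_of_mem_nhds x₀ hV).sdiff
    (sub1.finite.union sub2.finite)).nonempty
  exact ⟨(x, p), hxU, (isGeneric_iff hκ hA _).2 (not_or.1 hx)⟩

/-! ### The weights of the network -/

/-- Left multiplication by g scales all minors by det g, so ratios of minors depend only on the
class of `A`. The weights are the ratios that one reads off from the minors of the echelon form. -/
theorem existsUnique_weights (hA : IsTotallyPositive A) : ∃! w : Weights, w.Represents A := by
  have h01 := hA 0 1 (by decide)
  have h02 := hA 0 2 (by decide)
  have h03 := hA 0 3 (by decide)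
  have h12 := hA 1 2 (by decide)
  have h13 := hA 1 3 (by decide)
  have h23 := hA 2 3 (by decide)
  refine ⟨⟨minor A 1 2 / minor A 0 1, minor A 2 3 * minor A 0 1 / (minor A 1 2 * minor A 0 2),
    minor A 0 2 / minor A 0 1, minor A 0 3 / minor A 0 2⟩,
    ⟨⟨div_pos h12 h01, div_pos (mul_pos h23 h01) (mul_pos h12 h02), div_pos h02 h01,
      div_pos h03 h02⟩, !![A 0 0, A 0 1; A 1 0, A 1 1], ?_, ?_⟩, ?_⟩
  · rw [Matrix.det_fin_two_of]
    exact h01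
  · have n01 : minor A 0 1 ≠ 0 := h01.ne'
    have n02 : minor A 0 2 ≠ 0 := h02.ne'
    have n12 : minor A 1 2 ≠ 0 := h12.ne'
    ext i j
    fin_cases i <;> fin_cases j <;>
      simp [Weights.rref, Matrix.mul_apply, Fin.sum_univ_two] <;>
      field_simp <;> simp only [minor] <;> ring
  · rintro ⟨a, b, c, d⟩ ⟨⟨ha, hb, hc, hd⟩, g, hg, rfl⟩
    have m01 : minor (g * Weights.rref ⟨a, b, c, d⟩) 0 1 = g.det := by
      simp [minor, Weights.rref, Matrix.mul_apply, Fin.sum_univ_two, Matrix.det_fin_two]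
    have m02 : minor (g * Weights.rref ⟨a, b, c, d⟩) 0 2 = g.det * c := by
      simp [minor, Weights.rref, Matrix.mul_apply, Fin.sum_univ_two, Matrix.det_fin_two]
      ring
    have m03 : minor (g * Weights.rref ⟨a, b, c, d⟩) 0 3 = g.det * (c * d) := by
      simp [minor, Weights.rref, Matrix.mul_apply, Fin.sum_univ_two, Matrix.det_fin_two]
      ring
    have m12 : minor (g * Weights.rref ⟨a, b, c, d⟩) 1 2 = g.det * a := by
      simp [minor, Weights.rref, Matrix.mul_apply, Fin.sum_univ_two, Matrix.det_fin_two]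
      ring
    have m23 : minor (g * Weights.rref ⟨a, b, c, d⟩) 2 3 = g.det * (a * b * c) := by
      simp [minor, Weights.rref, Matrix.mul_apply, Fin.sum_univ_two, Matrix.det_fin_two]
      ring
    have hg' := hg.ne'
    dsimp only at ha hc
    rw [m01, m02, m03, m12, m23, Weights.mk.injEq]
    refine ⟨?_, ?_, ?_, ?_⟩ <;> field_simp

/-- The row relations of `A` are those of the echelon form multiplied by g; the adjugate of g undoes
this. -/
theorem Weights.Represents.dressedPhase_relations {w : Weights} (hw : w.Represents A)
    (hκ : StrictMono κ) (hA : IsTotallyPositive A) (s : Time) : dressedPhase κ A 0 s =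
      w.w13 * (dressedPhase κ A 2 s + (w.w14 + w.w24) * dressedPhase κ A 3 s) ∧
    dressedPhase κ A 1 s =
      -(w.w23 * (dressedPhase κ A 2 s + w.w24 * dressedPhase κ A 3 s)) := by
  have h0 := sum_mul_dressedPhase hκ hA 0 s
  have h1 := sum_mul_dressedPhase hκ hA 1 s
  obtain ⟨-, g, hg, hAg⟩ := hw
  have e : ∀ i j, A i j = g i 0 * w.rref 0 j + g i 1 * w.rref 1 j := fun i j => by
    rw [hAg, Matrix.mul_apply, Fin.sum_univ_two]
  simp only [e, Fin.sum_univ_four, Weights.rref, Matrix.of_apply, Matrix.cons_val] at h0 h1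
  rw [Matrix.det_fin_two] at hg
  constructor
  · apply mul_left_cancel₀ hg.ne'
    linear_combination g 1 1 * h0 - g 0 1 * h1
  · apply mul_left_cancel₀ hg.ne'
    linear_combination -g 1 0 * h0 + g 0 0 * h1

/-- The coefficients of the exponentials in the vacuum edge wavefunction. -/
def Edge.coeff (w : Weights) : Edge → Fin 4 → ℝ
  | .black24_b4 => ![0, 0, 0, 1]
  | .white23_b3 => ![0, 0, 1, 0]
  | .white23_black24 => ![0, 0, 0, w.w24]
  | .black23_white23 => ![0, 0, 1, w.w24]
  | .white13_black24 => ![0, 0, 0, w.w14]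
  | .white13_black23 => ![0, 0, 1, w.w24]
  | .b2_black23 => ![0, 0, w.w23, w.w23 * w.w24]
  | .b1_white13 => ![0, 0, w.w13, w.w13 * (w.w14 + w.w24)]

theorem vacuumWave_eq (w : Weights) (e : Edge) :
    vacuumWave κ w e = fun s => ∑ j, e.coeff w j * expPhase (κ j) s := by
  funext s
  cases e <;> simp [vacuumWave, Edge.coeff, Fin.sum_univ_four] <;> ring

theorem dressedWave_eq (w : Weights) (e : Edge) (s : Time) :
    dressedWave κ A w e s = ∑ j, e.coeff w j * dressedPhase κ A j s := by
  rw [dressedWave, vacuumWave_eq, darboux_expSum]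

end Signs

/-! ### Positions of the divisor points -/

theorem rpt_injective : Function.Injective rpt :=
  OnePoint.coe_injective.comp Complex.ofReal_injective

theorem rpt_ne_infty (x : ℝ) : rpt x ≠ ∞ := OnePoint.coe_ne_infty _

section Ovals

variable (κ : Fin 4 → ℝ) (x : ℝ)

theorem gamma0_mem_finiteOval :
    ((Comp.gamma0, rpt x) ∈ finiteOval κ 0 ↔ κ 0 ≤ x ∧ x ≤ κ 1) ∧
    ((Comp.gamma0, rpt x) ∈ finiteOval κ 1 ↔ κ 1 ≤ x ∧ x ≤ κ 2) ∧
    ((Comp.gamma0, rpt x) ∈ finiteOval κ 2 ↔ κ 2 ≤ x ∧ x ≤ κ 3) ∧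
    (Comp.gamma0, rpt x) ∉ finiteOval κ 3 := by
  simp [finiteOval, rpt_injective.mem_set_image]

theorem gamma13_mem_finiteOval :
    ((Comp.gamma13, rpt x) ∈ finiteOval κ 0 ↔ 1 ≤ x) ∧
    (Comp.gamma13, rpt x) ∉ finiteOval κ 1 ∧
    (Comp.gamma13, rpt x) ∉ finiteOval κ 2 ∧
    ((Comp.gamma13, rpt x) ∈ finiteOval κ 3 ↔ 0 ≤ x ∧ x ≤ 1) := by
  simp [finiteOval, rpt_injective.mem_set_image, rpt_ne_infty]

theorem gamma23_mem_finiteOval :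
    (Comp.gamma23, rpt x) ∉ finiteOval κ 0 ∧
    ((Comp.gamma23, rpt x) ∈ finiteOval κ 1 ↔ 1 ≤ x) ∧
    ((Comp.gamma23, rpt x) ∈ finiteOval κ 2 ↔ 0 ≤ x ∧ x ≤ 1) ∧
    ((Comp.gamma23, rpt x) ∈ finiteOval κ 3 ↔ x ≤ 0) := by
  simp [finiteOval, rpt_injective.mem_set_image, rpt_ne_infty]

theorem gamma23_infty_mem_finiteOval : (Comp.gamma23, (∞ : OnePoint ℂ)) ∈ finiteOval κ 1 := by
  simp [finiteOval]

theorem P0_mem_infiniteOval : P0 ∈ infiniteOval κ := by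
  simp [P0, infiniteOval]

theorem gamma0_mem_infiniteOval :
    (Comp.gamma0, rpt x) ∈ infiniteOval κ ↔ x ≤ κ 0 ∨ κ 3 ≤ x := by
  simp [infiniteOval, rpt_ne_infty, rpt_injective.mem_set_image]

theorem gamma13_mem_infiniteOval : (Comp.gamma13, rpt x) ∈ infiniteOval κ ↔ x ≤ 0 := by
  simp [infiniteOval, rpt_ne_infty, rpt_injective.mem_set_image]

theorem gamma23_notMem_infiniteOval (p : OnePoint ℂ) : (Comp.gamma23, p) ∉ infiniteOval κ := by
  simp [infiniteOval]

end Ovals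

theorem quadratic_roots {p r k m l : ℝ} (hk : 0 < k ^ 2 - p * k - r)
    (hm : m ^ 2 - p * m - r < 0) (hl : 0 < l ^ 2 - p * l - r) (hkm : k < m) (hml : m < l) :
    ∃ γ₁ γ₂ : ℝ, k < γ₁ ∧ γ₁ < γ₂ ∧ γ₂ < l ∧ γ₁ + γ₂ = p ∧ γ₁ * γ₂ = -r := by
  -- The discriminant equals (2m - p)² - 4(m² - pm - r), and the subtracted value is negative.
  have hd : 0 < p ^ 2 + 4 * r := by nlinarith [sq_nonneg (2 * m - p)]
  have hs := Real.sqrt_pos.2 hd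
  have hs2 := Real.sq_sqrt hd.le
  set q := √(p ^ 2 + 4 * r)
  have e : ∀ z, z ^ 2 - p * z - r = (z - (p - q) / 2) * (z - (p + q) / 2) := fun z => by
    linear_combination (1 / 4) * hs2
  rw [e] at hk hm hl
  have h1 : (p - q) / 2 < m := by
    by_contra! h
    exact hm.not_ge (mul_nonneg_of_nonpos_of_nonpos (by linarith) (by linarith))
  have h2 : m < (p + q) / 2 := by
    by_contra! h
    exact hm.not_ge (mul_nonneg (by linarith) (by linarith))
  refine ⟨(p - q) / 2, (p + q) / 2, ?_, by linarith, ?_, by ring,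
    by linear_combination (-1 / 4) * hs2⟩
  · by_contra! h
    exact hk.not_ge (mul_nonpos_of_nonneg_of_nonpos (by linarith) (by linarith))
  · by_contra! h
    exact hl.not_ge (mul_nonpos_of_nonneg_of_nonpos (by linarith) (by linarith))

section Positions

variable {κ : Fin 4 → ℝ} {A : Matrix (Fin 2) (Fin 4) ℝ}

/-- The two denominators are D_0/w13 and -D_1/w23, so their signs are those of D_0 and -D_1. -/
theorem Weights.Represents.denominators {w : Weights} (hw : w.Represents A)
    (hκ : StrictMono κ) (hA : IsTotallyPositive A) (s : Time) :
    0 < dressedPhase κ A 2 s + (w.w14 + w.w24) * dressedPhase κ A 3 s ∧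
    (0 < dressedPhase κ A 2 s + w.w24 * dressedPhase κ A 3 s ↔ dressedPhase κ A 1 s < 0) ∧
    (dressedPhase κ A 2 s + w.w24 * dressedPhase κ A 3 s < 0 ↔ 0 < dressedPhase κ A 1 s) ∧
    (dressedPhase κ A 2 s + w.w24 * dressedPhase κ A 3 s = 0 ↔ dressedPhase κ A 1 s = 0) := by
  obtain ⟨h0, h1⟩ := hw.dressedPhase_relations hκ hA s
  refine ⟨pos_of_mul_pos_right (h0 ▸ dressedPhase_zero_pos hκ hA s) hw.1.1.le, ?_⟩
  have hc := hw.1.2.2.1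
  rw [h1]
  refine ⟨?_, ?_, ?_⟩
  · rw [neg_lt_zero, mul_pos_iff_of_pos_left hc]
  · rw [neg_pos, ← mul_lt_mul_iff_right₀ hc, mul_zero]
  · rw [neg_eq_zero, mul_eq_zero_iff_left hc.ne']

/-- The symbol is positive at both end phases and negative at κ 1 or κ 2: if D_1 ≥ 0, then D_2 ≤
-w24 D_3 < 0. -/
theorem exists_sato_roots (hκ : StrictMono κ) (hA : IsTotallyPositive A) (s : Time) :
    ∃ γ₁ γ₂ : ℝ, κ 0 < γ₁ ∧ γ₁ < γ₂ ∧ γ₂ < κ 3 ∧ γ₁ + γ₂ = coeff1 κ A s ∧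
      γ₁ * γ₂ = -coeff2 κ A s := by
  obtain ⟨w, hw, -⟩ := existsUnique_weights hA
  have hneg : ∃ l : Fin 4, 0 < l ∧ l < 3 ∧ dressedPhase κ A l s < 0 := by
    by_cases h : dressedPhase κ A 1 s < 0
    · exact ⟨1, by decide, by decide, h⟩
    · have h2 := (not_congr (hw.denominators hκ hA s).2.1).2 h
      have := mul_pos hw.1.2.2.2 (dressedPhase_three_pos hκ hA s)
      exact ⟨2, by decide, by decide, by linarith⟩
  obtain ⟨l, hl0, hl3, hl⟩ := hneg
  rw [dressedPhase_eq] at hl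
  exact quadratic_roots (symbol_pos_of_le hκ hA s le_rfl)
    (neg_of_mul_neg_left hl (expPhase_pos _ _).le) (symbol_pos_of_ge hκ hA s le_rfl)
    (hκ hl0) (hκ hl3)

theorem dressedPhase_eq_of_roots {γ₁ γ₂ : ℝ} {s : Time} (h1 : γ₁ + γ₂ = coeff1 κ A s)
    (h2 : γ₁ * γ₂ = -coeff2 κ A s) (l : Fin 4) :
    dressedPhase κ A l s = (κ l - γ₁) * (κ l - γ₂) * expPhase (κ l) s := by
  rw [dressedPhase_eq, ← h1, ← neg_eq_iff_eq_neg.2 h2]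
  ring

/-- D_l is (κ l - γ₁)(κ l - γ₂) times a positive exponential, so its sign tells on which side of the
roots κ l lies. -/
theorem roots_of_dressedPhase {γ₁ γ₂ : ℝ} {s : Time} (h1 : γ₁ + γ₂ = coeff1 κ A s)
    (h2 : γ₁ * γ₂ = -coeff2 κ A s) (hlt : γ₁ < γ₂) (l : Fin 4) :
    (dressedPhase κ A l s < 0 ↔ γ₁ < κ l ∧ κ l < γ₂) ∧
    (dressedPhase κ A l s = 0 ↔ γ₁ = κ l ∨ γ₂ = κ l) ∧
    (0 < dressedPhase κ A l s ↔ κ l < γ₁ ∨ γ₂ < κ l) := by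
  rw [dressedPhase_eq_of_roots h1 h2]
  have he := expPhase_pos (κ l) s
  refine ⟨?_, ?_, ?_⟩
  · rw [← neg_pos, ← neg_mul, mul_pos_iff_of_pos_right he, neg_pos, mul_neg_iff]
    constructor
    · rintro (⟨h, h'⟩ | ⟨h, h'⟩) <;> constructor <;> linarith
    · exact fun h => Or.inl ⟨by linarith, by linarith⟩
  · rw [mul_eq_zero_iff_right he.ne', mul_eq_zero, sub_eq_zero, sub_eq_zero, eq_comm,
      eq_comm (a := κ l)]
  · rw [mul_pos_iff_of_pos_right he, mul_pos_iff]
    constructor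
    · rintro (⟨h, h'⟩ | ⟨h, h'⟩)
      · exact Or.inr (by linarith)
      · exact Or.inl (by linarith)
    · rintro (h | h)
      · exact Or.inr ⟨by linarith, by linarith⟩
      · exact Or.inl ⟨by linarith, by linarith⟩

open Polynomial in
theorem satoPoly_eq {γ₁ γ₂ : ℝ} {s : Time} (h1 : γ₁ + γ₂ = coeff1 κ A s)
    (h2 : γ₁ * γ₂ = -coeff2 κ A s) :
    satoPoly κ A s = (X - C (γ₁ : ℂ)) * (X - C (γ₂ : ℂ)) := by
  rw [satoPoly, ← h1, ← neg_eq_iff_eq_neg.2 h2]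
  push_cast
  simp only [map_add, map_neg, map_mul]
  ring

theorem dressedWave_white (w : Weights) (s : Time) :
    dressedWave κ A w .white13_black24 s = w.w14 * dressedPhase κ A 3 s ∧
    dressedWave κ A w .white13_black23 s =
      dressedPhase κ A 2 s + w.w24 * dressedPhase κ A 3 s ∧
    dressedWave κ A w .white23_black24 s = w.w24 * dressedPhase κ A 3 s ∧
    dressedWave κ A w .white23_b3 s = dressedPhase κ A 2 s := by
  simp [dressedWave_eq, Edge.coeff, Fin.sum_univ_four]

theorem kpDivisor_eq (hκ : StrictMono κ) (hA : IsTotallyPositive A) {w : Weights}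
    (hw : w.Represents A) {γ₁ γ₂ : ℝ} {s : Time}
    (h1 : γ₁ + γ₂ = coeff1 κ A s) (h2 : γ₁ * γ₂ = -coeff2 κ A s) :
    kpDivisor κ A w s = {(Comp.gamma0, rpt γ₁), (Comp.gamma0, rpt γ₂),
      (Comp.gamma13, rpt (w.w14 * dressedPhase κ A 3 s /
        (dressedPhase κ A 2 s + (w.w14 + w.w24) * dressedPhase κ A 3 s))),
      (Comp.gamma23, divisorNumber (w.w24 * dressedPhase κ A 3 s) (dressedPhase κ A 2 s))} := by
  have hr : (satoPoly κ A s).roots = {(γ₁ : ℂ), (γ₂ : ℂ)} := by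
    rw [satoPoly_eq h1 h2, Polynomial.roots_mul (mul_ne_zero (Polynomial.X_sub_C_ne_zero _)
      (Polynomial.X_sub_C_ne_zero _)), Polynomial.roots_X_sub_C, Polynomial.roots_X_sub_C]
    rfl
  have hsum : w.w14 * dressedPhase κ A 3 s +
      (dressedPhase κ A 2 s + w.w24 * dressedPhase κ A 3 s) =
      dressedPhase κ A 2 s + (w.w14 + w.w24) * dressedPhase κ A 3 s := by ring
  obtain ⟨e1, e2, e3, e4⟩ := dressedWave_white (κ := κ) (A := A) w s
  rw [kpDivisor, hr, e1, e2, e3, e4, divisorNumber, hsum,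
    if_neg (hw.denominators hκ hA s).1.ne']
  rfl

open Classical in
-- The strict inequalities keep every point away from the double points, hence in the interior of an
-- arc of a single oval; the three alternatives are the generic configurations.
theorem card_filter_finiteOval {γ₁ γ₂ p q : ℝ} {D : Multiset Point}
    (hD : D = {(Comp.gamma0, rpt γ₁), (Comp.gamma0, rpt γ₂), (Comp.gamma13, rpt p),
      (Comp.gamma23, rpt q)}) (hκ : StrictMono κ)
    (h : (κ 0 < γ₁ ∧ γ₁ < κ 1 ∧ κ 1 < γ₂ ∧ γ₂ < κ 2 ∧ 0 < p ∧ p < 1 ∧ 0 < q ∧ q < 1) ∨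
      (κ 0 < γ₁ ∧ γ₁ < κ 1 ∧ κ 2 < γ₂ ∧ γ₂ < κ 3 ∧ 0 < p ∧ p < 1 ∧ 1 < q) ∨
      (κ 1 < γ₁ ∧ γ₁ < κ 2 ∧ κ 2 < γ₂ ∧ γ₂ < κ 3 ∧ 1 < p ∧ q < 0)) (j : Fin 4) :
    (D.filter (· ∈ finiteOval κ j)).card = 1 := by
  have h01 : κ 0 < κ 1 := hκ (by decide)
  have h12 : κ 1 < κ 2 := hκ (by decide)
  have h23 : κ 2 < κ 3 := hκ (by decide)
  rw [← Multiset.countP_eq_card_filter, hD]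
  simp only [Multiset.insert_eq_cons, Multiset.countP_cons, ← Multiset.cons_zero,
    Multiset.countP_zero]
  rcases h with ⟨a, b, c, d, e, f, g, i⟩ | ⟨a, b, c, d, e, f, g⟩ | ⟨a, b, c, d, e, f⟩ <;>
    fin_cases j <;>
    simp only [Fin.zero_eta, Fin.mk_one, Fin.reduceFinMk, gamma0_mem_finiteOval,
      gamma13_mem_finiteOval, gamma23_mem_finiteOval, if_false] <;>
    grind

end Positions

/-! ### Meromorphic functions on the projective line -/

/-- Without common zeros, a quotient of continuous functions is a continuous map into the Riemann
sphere. -/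
theorem continuous_ite_infty_div {p r : ℂ → ℂ} (hp : Continuous p) (hr : Continuous r)
    (h : ∀ z, r z = 0 → p z ≠ 0) :
    Continuous fun z => if r z = 0 then (∞ : OnePoint ℂ) else ((p z / r z : ℂ) : OnePoint ℂ) := by
  rw [continuous_iff_continuousAt]
  intro z
  by_cases hz : r z = 0
  · rw [ContinuousAt, if_pos hz]
    refine Filter.Tendsto.if tendsto_const_nhds ?_
    -- Near a zero of `r`, off the zero set, r/p tends to 0 through nonzero values, so its inverse
    -- p/r tends to ∞.
    have h1 : Filter.Tendsto (fun z => r z / p z) (𝓝 z ⊓ Filter.principal {z | ¬r z = 0})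
        (𝓝[≠] 0) := by
      rw [tendsto_nhdsWithin_iff]
      constructor
      · have := (hr.continuousAt (x := z)).div (hp.continuousAt (x := z)) (h z hz)
        rw [ContinuousAt, Pi.div_apply, hz, zero_div] at this
        exact this.mono_left inf_le_left
      · have hne : ∀ᶠ y in 𝓝 z, p y ≠ 0 := hp.continuousAt.eventually_ne (h z hz)
        filter_upwards [hne.filter_mono inf_le_left,
          Filter.mem_inf_of_right (Filter.mem_principal_self _)] with y hy hy'
        exact div_ne_zero hy' hy
    have h2 := Filter.tendsto_inv₀_nhdsNE_zero.comp h1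
    rw [Metric.cobounded_eq_cocompact, ← Filter.coclosedCompact_eq_cocompact] at h2
    refine (OnePoint.tendsto_coe_infty.comp h2).congr fun y => ?_
    simp
  · have hne : ∀ᶠ y in 𝓝 z, r y ≠ 0 := hr.continuousAt.eventually_ne hz
    refine ContinuousAt.congr (f := fun y => ((p y / r y : ℂ) : OnePoint ℂ)) ?_ ?_
    · exact OnePoint.continuous_coe.continuousAt.comp
        (hp.continuousAt.div hr.continuousAt hz)
    · filter_upwards [hne] with y hy
      rw [if_neg hy]

open Polynomial in
-- Cancelling the common factor of `P` and `Q` makes numerator and denominator coprime, so they have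
-- no common zero; the factor `E` adds none.
theorem exists_continuous_eval_div (P Q : ℂ[X]) (hQ : Q ≠ 0) {E : ℂ → ℂ} (hE : Continuous E)
    (hE0 : ∀ z, E z ≠ 0) : ∃ f : ℂ → OnePoint ℂ, Continuous f ∧
      ∀ z, Q.eval z ≠ 0 → f z = ((P.eval z / Q.eval z * E z : ℂ) : OnePoint ℂ) := by
  obtain ⟨q, p, c, hqp, rfl, rfl⟩ := UniqueFactorizationMonoid.exists_reduced_factors Q hQ P
  obtain ⟨a, b, hab⟩ := hqp.isCoprime
  refine ⟨_, continuous_ite_infty_div (p := fun z => p.eval z * E z) (p.continuous.mul hE)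
    q.continuous fun z hz hz' => ?_, fun z hz => ?_⟩
  · have := congrArg (Polynomial.eval z) hab
    rw [eval_add, eval_mul, eval_mul, hz, (mul_eq_zero_iff_right (hE0 z)).1 hz', mul_zero,
      mul_zero, add_zero, eval_one] at this
    exact zero_ne_one this
  · rw [eval_mul, mul_ne_zero_iff] at hz
    rw [if_neg hz.2, eval_mul, eval_mul, mul_div_mul_left _ _ hz.1, div_mul_eq_mul_div]

theorem meromorphicOrderAt_div_nonneg {n d : ℂ → ℂ} {x : ℂ} (hn : AnalyticAt ℂ n x)
    (hd : AnalyticAt ℂ d x) (h0 : d x ≠ 0) : 0 ≤ meromorphicOrderAt (fun u => n u / d u) x :=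
  (hn.fun_div hd h0).meromorphicOrderAt_nonneg

theorem meromorphicOrderAt_div_mul_self {n d : ℂ → ℂ} (hn : AnalyticAt ℂ n 0)
    (hd : AnalyticAt ℂ d 0) (h0 : d 0 ≠ 0) :
    0 ≤ meromorphicOrderAt (fun u => n u / (u * d u)) 0 + 1 ∧
    (n 0 ≠ 0 → meromorphicOrderAt (fun u => n u / (u * d u)) 0 = -1) := by
  have e : (fun u => n u / (u * d u)) = (fun u => n u / d u) / id := by
    funext u
    simp only [Pi.div_apply, id]
    rw [div_div, mul_comm]
  have hq : AnalyticAt ℂ (fun u => n u / d u) 0 := hn.fun_div hd h0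
  rw [e, meromorphicOrderAt_div hq.meromorphicAt analyticAt_id.meromorphicAt,
    meromorphicOrderAt_id]
  constructor
  · have := hq.meromorphicOrderAt_nonneg
    cases h : meromorphicOrderAt (fun u => n u / d u) 0 with
    | top => exact le_top
    | coe k =>
      rw [h] at this
      norm_cast at this ⊢
      simpa using this
  · intro hn0
    have : meromorphicOrderAt (fun u => n u / d u) 0 = 0 := by
      rw [← tendsto_ne_zero_iff_meromorphicOrderAt_eq_zero hq.meromorphicAt]
      exact ⟨n 0 / d 0, div_ne_zero hn0 h0, hq.continuousAt.tendsto.mono_left nhdsWithin_le_nhds⟩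
    rw [this]
    rfl

theorem orderAt_const (c : ℂ) (g : OnePoint ℂ → OnePoint ℂ) (hg : ∀ z, g z = (c : OnePoint ℂ))
    (p : OnePoint ℂ) : 0 ≤ orderAt g p := by
  have : (fun u : ℂ => finitePart (g (localChart p u))) = fun _ => c := by
    funext u
    rw [hg]
    rfl
  rw [orderAt, this]
  exact analyticAt_const.meromorphicOrderAt_nonneg

theorem orderAt_coe_congr {g : OnePoint ℂ → OnePoint ℂ} {z : ℂ} {f : ℂ → ℂ}
    (h : ∀ᶠ u in 𝓝[≠] (0 : ℂ), g ((z + u : ℂ) : OnePoint ℂ) = (f u : OnePoint ℂ)) :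
    orderAt g z = meromorphicOrderAt f 0 := by
  refine meromorphicOrderAt_congr ?_
  filter_upwards [h] with u hu
  change finitePart (g ((z + u : ℂ) : OnePoint ℂ)) = f u
  rw [hu]
  rfl

theorem orderAt_infty_congr {g : OnePoint ℂ → OnePoint ℂ} {f : ℂ → ℂ}
    (h : ∀ᶠ u in 𝓝[≠] (0 : ℂ), g ((u⁻¹ : ℂ) : OnePoint ℂ) = (f u : OnePoint ℂ)) :
    orderAt g ∞ = meromorphicOrderAt f 0 := by
  refine meromorphicOrderAt_congr ?_
  filter_upwards [h, self_mem_nhdsWithin] with u hu hu0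
  change finitePart (g (if u = 0 then ∞ else ((u⁻¹ : ℂ) : OnePoint ℂ))) = f u
  rw [if_neg (show u ≠ 0 from hu0), hu]
  rfl

/-- A Möbius map separates 0 and 1, so it cannot agree with a constant at both; for two Möbius maps
the quotient fixes 0, 1, ∞ and is the identity. -/
theorem IsMeromorphicDegLeOne.ext {g h : OnePoint ℂ → OnePoint ℂ} (hg : IsMeromorphicDegLeOne g)
    (hh : IsMeromorphicDegLeOne h) (h0 : g (rpt 0) = h (rpt 0)) (h1 : g (rpt 1) = h (rpt 1))
    (hi : g ∞ = h ∞) : g = h := by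
  have n01 : rpt 0 ≠ rpt 1 := fun e => zero_ne_one (rpt_injective e)
  rcases hg with ⟨c, hc⟩ | ⟨m, hm⟩ <;> rcases hh with ⟨c', hc'⟩ | ⟨m', hm'⟩
  · funext z
    rw [hc, hc', ← hc ∞, ← hc' ∞, hi]
  · rw [hc, hm'] at h0 h1
    exact absurd (MulAction.injective m' (h0.symm.trans h1)) n01
  · rw [hc', hm] at h0 h1
    exact absurd (MulAction.injective m (h0.trans h1.symm)) n01
  · rw [hm, hm'] at h0 h1 hi
    set n := m'⁻¹ * m with hn
    have key : ∀ z : OnePoint ℂ, m • z = m' • z → n • z = z := fun z hz => by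
      rw [hn, mul_smul, hz, inv_smul_smul]
    have f0 := key _ h0
    have f1 := key _ h1
    have c0 : n 1 0 = 0 := OnePoint.smul_infty_eq_self_iff.1 (key _ hi)
    rw [rpt, OnePoint.smul_some_eq_ite, c0, zero_mul, zero_add] at f0 f1
    have d0 : n 1 1 ≠ 0 := fun hd => by
      rw [if_pos hd] at f0
      exact OnePoint.infty_ne_coe _ f0
    rw [if_neg d0, OnePoint.coe_eq_coe, div_eq_iff d0] at f0 f1
    have b0 : n 0 1 = 0 := by simpa using f0
    have ad : n 0 0 = n 1 1 := by simpa [b0] using f1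
    have hid : ∀ z : OnePoint ℂ, n • z = z := fun z => by
      cases z with
      | infty => exact key _ hi
      | coe z => rw [OnePoint.smul_some_eq_ite, c0, zero_mul, zero_add, if_neg d0, b0, ad,
          add_zero, mul_div_cancel_left₀ _ d0]
    funext z
    have := hid z
    rw [hn, mul_smul, inv_smul_eq_iff] at this
    rw [hm, hm', this]

/-- The function of degree at most one with the values `a / a₀`, `b / b₀`,
`(a + b) / (a₀ + b₀)` at `0`, `1`, `∞`. -/
noncomputable def mobiusWave (a b a₀ b₀ : ℂ) (z : OnePoint ℂ) : OnePoint ℂ :=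
  if h : a * b₀ - b * a₀ = 0 then ((a / a₀ : ℂ) : OnePoint ℂ)
  else Matrix.GeneralLinearGroup.mkOfDetNeZero !![a + b, -a; a₀ + b₀, -a₀] (by
    rw [Matrix.det_fin_two_of]
    contrapose! h
    linear_combination h) • z

/-! ### Values and poles of the degree-one functions on the white components -/

section MobiusWave

variable (a b : ℂ) {a₀ b₀ : ℂ}

theorem isMeromorphicDegLeOne_mobiusWave (a₀ b₀ : ℂ) :
    IsMeromorphicDegLeOne (mobiusWave a b a₀ b₀) := by
  by_cases h : a * b₀ - b * a₀ = 0
  · exact Or.inl ⟨a / a₀, fun z => dif_pos h⟩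
  · exact Or.inr ⟨_, fun z => dif_neg h⟩

/-- The formula also covers the degenerate determinant, where the quotient reduces to a/a₀. Orders
can thus be computed without splitting cases. -/
theorem mobiusWave_coe (ha : a₀ ≠ 0) {z : ℂ} (hz : (a₀ + b₀) * z - a₀ ≠ 0) :
    mobiusWave a b a₀ b₀ (z : OnePoint ℂ) =
      ((((a + b) * z - a) / ((a₀ + b₀) * z - a₀) : ℂ) : OnePoint ℂ) := by
  by_cases h : a * b₀ - b * a₀ = 0
  · rw [mobiusWave, dif_pos h, OnePoint.coe_eq_coe, div_eq_div_iff ha hz]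
    linear_combination z * h
  · rw [mobiusWave, dif_neg h, OnePoint.smul_some_eq_ite]
    simp only [Matrix.GeneralLinearGroup.mkOfDetNeZero,
      Matrix.GeneralLinearGroup.val_mk', Matrix.of_apply, Matrix.cons_val]
    rw [if_neg (by rwa [← sub_eq_add_neg])]
    simp only [sub_eq_add_neg]

theorem mobiusWave_zero (ha : a₀ ≠ 0) :
    mobiusWave a b a₀ b₀ (rpt 0) = ((a / a₀ : ℂ) : OnePoint ℂ) := by
  rw [rpt, mobiusWave_coe a b ha (by simpa using ha)]
  simp

theorem mobiusWave_one (ha : a₀ ≠ 0) (hb : b₀ ≠ 0) :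
    mobiusWave a b a₀ b₀ (rpt 1) = ((b / b₀ : ℂ) : OnePoint ℂ) := by
  rw [rpt, mobiusWave_coe a b ha (by simpa using hb)]
  simp

theorem mobiusWave_infty (ha : a₀ ≠ 0) (hab : a₀ + b₀ ≠ 0) :
    mobiusWave a b a₀ b₀ ∞ = (((a + b) / (a₀ + b₀) : ℂ) : OnePoint ℂ) := by
  by_cases h : a * b₀ - b * a₀ = 0
  · rw [mobiusWave, dif_pos h, OnePoint.coe_eq_coe, div_eq_div_iff ha hab]
    linear_combination h
  · rw [mobiusWave, dif_neg h, OnePoint.smul_infty_eq_ite]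
    simp [Matrix.GeneralLinearGroup.mkOfDetNeZero, hab]

theorem orderAt_mobiusWave_nonneg (ha : a₀ ≠ 0) (hab : a₀ + b₀ ≠ 0) {p : OnePoint ℂ}
    (hp : p ≠ ((a₀ / (a₀ + b₀) : ℂ) : OnePoint ℂ)) : 0 ≤ orderAt (mobiusWave a b a₀ b₀) p := by
  cases p with
  | infty =>
    have hc : Continuous fun u : ℂ => (a₀ + b₀) - a₀ * u := by fun_prop
    have h0 : (a₀ + b₀) - a₀ * 0 ≠ 0 := by simpa using hab
    rw [orderAt_infty_congr (f := fun u => ((a + b) - a * u) / ((a₀ + b₀) - a₀ * u))]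
    · exact meromorphicOrderAt_div_nonneg (by fun_prop) (by fun_prop) h0
    · filter_upwards [self_mem_nhdsWithin,
        (hc.continuousAt.eventually_ne h0).filter_mono nhdsWithin_le_nhds] with u hu hu'
      have hu : u ≠ 0 := hu
      have e : ∀ x y : ℂ, x * u⁻¹ - y = (x - y * u) / u := fun x y => by field_simp
      rw [mobiusWave_coe a b ha (by rw [e]; exact div_ne_zero hu' hu), e, e,
        div_div_div_cancel_right₀ hu]
  | coe z =>
    have hc : Continuous fun u : ℂ => (a₀ + b₀) * (z + u) - a₀ := by fun_prop
    have h0 : (a₀ + b₀) * (z + 0) - a₀ ≠ 0 := fun h => hp (by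
      rw [OnePoint.coe_eq_coe, eq_div_iff hab]
      linear_combination h)
    rw [orderAt_coe_congr (f := fun u => ((a + b) * (z + u) - a) / ((a₀ + b₀) * (z + u) - a₀))]
    · exact meromorphicOrderAt_div_nonneg (by fun_prop) (by fun_prop) h0
    · filter_upwards [(hc.continuousAt.eventually_ne h0).filter_mono nhdsWithin_le_nhds]
        with u hu
      exact mobiusWave_coe a b ha hu

theorem orderAt_mobiusWave_pole (ha : a₀ ≠ 0) (hab : a₀ + b₀ ≠ 0) :
    0 ≤ orderAt (mobiusWave a b a₀ b₀) ((a₀ / (a₀ + b₀) : ℂ) : OnePoint ℂ) + 1 ∧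
    (a * b₀ - b * a₀ ≠ 0 →
      orderAt (mobiusWave a b a₀ b₀) ((a₀ / (a₀ + b₀) : ℂ) : OnePoint ℂ) = -1) := by
  have e : ∀ u : ℂ, (a₀ + b₀) * (a₀ / (a₀ + b₀) + u) - a₀ = u * (a₀ + b₀) := fun u => by
    field_simp
    ring
  rw [orderAt_coe_congr
    (f := fun u => ((a + b) * (a₀ / (a₀ + b₀) + u) - a) / (u * (a₀ + b₀)))]
  · obtain ⟨h1, h2⟩ := meromorphicOrderAt_div_mul_self
      (n := fun u => (a + b) * (a₀ / (a₀ + b₀) + u) - a) (d := fun _ => a₀ + b₀)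
      (by fun_prop) (by fun_prop) hab
    refine ⟨h1, fun h => h2 fun h' => h ?_⟩
    field_simp at h'
    linear_combination -h'
  · filter_upwards [self_mem_nhdsWithin] with u hu
    rw [mobiusWave_coe a b ha (by rw [e]; exact mul_ne_zero hu hab), e]

end MobiusWave

/-! ### Pole divisors with simple points -/

/-- A multiset without repetition lies below D' as soon as its points lie in D', and a pole of order
one at some time forces its point into every dominating divisor. -/
theorem isPoleDivisor_of_simple {ψ : Wave} {D : Multiset Point} (hD : D.Nodup) (hP : P0 ∉ D)
    (hreg : ∀ s p, p ≠ P0 → p ∉ D → 0 ≤ orderAt (ψ s p.1) p.2)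
    (hpole : ∀ s, ∀ p ∈ D, 0 ≤ orderAt (ψ s p.1) p.2 + 1)
    (hmin : ∀ p ∈ D, ∃ s, orderAt (ψ s p.1) p.2 = -1) : IsPoleDivisor ψ D := by
  classical
  refine ⟨⟨hP, fun s p hp => ?_⟩, fun D' hD' => ?_⟩
  · by_cases hpD : p ∈ D
    · refine (hpole s p hpD).trans (add_le_add_right ?_ _)
      exact_mod_cast Multiset.one_le_count_iff_mem.2 hpD
    · exact add_nonneg (hreg s p hp hpD) (by exact_mod_cast Nat.zero_le _)
  · refine (Multiset.le_iff_subset hD).2 fun p hp => ?_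
    obtain ⟨s, hs⟩ := hmin p hp
    have := hD'.2 s p fun h => hP (h ▸ hp)
    by_contra hp'
    rw [hs, Multiset.count_eq_zero_of_notMem hp'] at this
    exact absurd this (by decide)

/-! ### The normalized wavefunction -/

section NormalizedWave

variable {κ : Fin 4 → ℝ} {A : Matrix (Fin 2) (Fin 4) ℝ}

theorem satoWave_eq_eval (z : ℂ) (s : Time) :
    satoWave κ A z s = (satoPoly κ A s).eval z * expTheta z s := by
  rw [satoWave_eq, satoPoly]
  simp

theorem satoPoly_ne_zero (s : Time) : satoPoly κ A s ≠ 0 := by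
  have : (satoPoly κ A s).coeff 2 = 1 := by
    simp [satoPoly]
  intro h
  rw [h, Polynomial.coeff_zero] at this
  exact zero_ne_one this

theorem satoPoly_eval_eq_zero_iff {γ₁ γ₂ : ℝ} {s : Time} (h1 : γ₁ + γ₂ = coeff1 κ A s)
    (h2 : γ₁ * γ₂ = -coeff2 κ A s) (z : ℂ) :
    (satoPoly κ A s).eval z = 0 ↔ z = γ₁ ∨ z = γ₂ := by
  rw [satoPoly_eq h1 h2]
  simp [sub_eq_zero]

theorem analyticAt_expTheta_add (z : ℂ) (s : Time) :
    AnalyticAt ℂ (fun u => expTheta (z + u) s) 0 := by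
  unfold expTheta
  fun_prop

/-- The Sato polynomials at `s` and `s₀` may share roots, where the plain quotient has no meaning;
the reduced fraction supplies the value there. -/
theorem exists_sato_extension (κ : Fin 4 → ℝ) (A : Matrix (Fin 2) (Fin 4) ℝ) (s₀ s : Time) :
    ∃ f : ℂ → OnePoint ℂ, Continuous f ∧ ∀ z, satoWave κ A z s₀ ≠ 0 →
      f z = ((satoWave κ A z s / satoWave κ A z s₀ : ℂ) : OnePoint ℂ) := by
  have hE : ∀ s, Continuous fun z => expTheta z s := fun s => by
    unfold expTheta
    fun_prop
  obtain ⟨f, hf, h⟩ := exists_continuous_eval_div (satoPoly κ A s) (satoPoly κ A s₀)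
    (satoPoly_ne_zero s₀) (E := fun z => expTheta z s / expTheta z s₀)
    ((hE s).div (hE s₀) fun z => expTheta_ne_zero z s₀)
    fun z => div_ne_zero (expTheta_ne_zero z s) (expTheta_ne_zero z s₀)
  refine ⟨f, hf, fun z hz => ?_⟩
  rw [satoWave_eq_eval, mul_ne_zero_iff] at hz
  rw [h z hz.1, satoWave_eq_eval, satoWave_eq_eval, div_mul_div_comm]

theorem dense_satoWave_ne_zero (s₀ : Time) : Dense {z : ℂ | satoWave κ A z s₀ ≠ 0} := by
  refine (dense_univ.sdiff_finite
    (Polynomial.finite_setOfPred_isRoot (satoPoly_ne_zero (κ := κ) (A := A) s₀))).mono ?_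
  rintro z ⟨-, hz⟩
  rw [Set.mem_ofPred_eq, satoWave_eq_eval]
  exact mul_ne_zero hz (expTheta_ne_zero z s₀)

/-- At a root of the Sato polynomial for `s₀` the denominator is u times a function that does not
vanish at u = 0, because the roots are distinct. The pole is then genuine when the numerator is
nonzero. -/
theorem IsKPWave.orderAt_gamma0 {s₀ : Time} {ψ : Wave} (hψ : IsKPWave κ A s₀ ψ) {γ₁ γ₂ : ℝ}
    (h1 : γ₁ + γ₂ = coeff1 κ A s₀) (h2 : γ₁ * γ₂ = -coeff2 κ A s₀) (hlt : γ₁ ≠ γ₂)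
    (s : Time) (z : ℂ) :
    (z ≠ γ₁ → z ≠ γ₂ → 0 ≤ orderAt (ψ s .gamma0) z) ∧
    (z = γ₁ ∨ z = γ₂ → 0 ≤ orderAt (ψ s .gamma0) z + 1 ∧
      ((satoPoly κ A s).eval z ≠ 0 → orderAt (ψ s .gamma0) z = -1)) := by
  have hn : AnalyticAt ℂ (fun u => satoWave κ A (z + u) s) 0 := by
    simp only [satoWave_eq_eval]
    have := analyticAt_expTheta_add z s
    have hp : AnalyticAt ℂ (fun u => (satoPoly κ A s).eval (z + u)) 0 := by
      simp only [satoPoly, Polynomial.eval_sub, Polynomial.eval_mul, Polynomial.eval_pow,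
        Polynomial.eval_X, Polynomial.eval_C]
      fun_prop
    exact hp.fun_mul this
  have hd : ∀ u, satoWave κ A (z + u) s₀ =
      (z + u - γ₁) * (z + u - γ₂) * expTheta (z + u) s₀ := fun u => by
    rw [satoWave_eq_eval, satoPoly_eq h1 h2]
    simp
  have hE := analyticAt_expTheta_add z s₀
  have hord : orderAt (ψ s .gamma0) z =
      meromorphicOrderAt (fun u => satoWave κ A (z + u) s / satoWave κ A (z + u) s₀) 0 := by
    refine orderAt_coe_congr ?_
    have hfin : {u : ℂ | satoWave κ A (z + u) s₀ = 0}.Finite := by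
      refine (Set.toFinite {(γ₁ - z : ℂ), (γ₂ - z : ℂ)}).subset fun u hu => ?_
      rw [Set.mem_ofPred_eq, hd, mul_eq_zero_iff_right (expTheta_ne_zero _ _), mul_eq_zero] at hu
      rcases hu with h | h
      · exact Or.inl (by linear_combination h)
      · exact Or.inr (by rw [Set.mem_singleton_iff]; linear_combination h)
    -- Away from the finitely many nonzero zeros and from u = 0 itself, ψ is given by the quotient;
    -- this suffices, since the order only sees a punctured neighbourhood.
    have hev := (hfin.sdiff (t := {0})).isClosed.isOpen_compl.mem_nhds
      (fun h => h.2 rfl)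
    filter_upwards [mem_nhdsWithin_of_mem_nhds hev, self_mem_nhdsWithin] with u hu hu0
    exact hψ.sato s _ fun h => hu ⟨h, hu0⟩
  rw [hord]
  constructor
  · intro hz1 hz2
    refine meromorphicOrderAt_div_nonneg hn ?_ ?_
    · simp only [hd]
      fun_prop
    · rw [hd, add_zero]
      exact mul_ne_zero (mul_ne_zero (sub_ne_zero.2 hz1) (sub_ne_zero.2 hz2))
        (expTheta_ne_zero _ _)
  · have key : ∀ c : ℂ, z ≠ c → (∀ u, satoWave κ A (z + u) s₀ =
        u * ((z + u - c) * expTheta (z + u) s₀)) →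
        0 ≤ meromorphicOrderAt
          (fun u => satoWave κ A (z + u) s / satoWave κ A (z + u) s₀) 0 + 1 ∧
        ((satoPoly κ A s).eval z ≠ 0 → meromorphicOrderAt
          (fun u => satoWave κ A (z + u) s / satoWave κ A (z + u) s₀) 0 = -1) := by
      intro c hc h
      simp only [h]
      obtain ⟨k1, k2⟩ := meromorphicOrderAt_div_mul_self hn
        (d := fun u => (z + u - c) * expTheta (z + u) s₀) (by fun_prop)
        (by rw [add_zero]; exact mul_ne_zero (sub_ne_zero.2 hc) (expTheta_ne_zero _ _))
      refine ⟨k1, fun hP => k2 ?_⟩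
      rw [add_zero, satoWave_eq_eval]
      exact mul_ne_zero hP (expTheta_ne_zero _ _)
    have hne : (γ₁ : ℂ) ≠ γ₂ := fun h => hlt (Complex.ofReal_injective h)
    rintro (rfl | rfl)
    · exact key γ₂ hne fun u => by rw [hd]; ring
    · exact key γ₁ hne.symm fun u => by rw [hd]; ring

/-- In the three generic sign patterns the two roots occupy different pairs out of the regions below
κ 1, between κ 1 and κ 2, and above κ 2. No region belongs to all three pairs, so no root can
persist for all times. -/
theorem exists_satoPoly_eval_ne_zero (hκ : StrictMono κ) (hA : IsTotallyPositive A) (γ : ℝ) :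
    ∃ s, (satoPoly κ A s).eval (γ : ℂ) ≠ 0 := by
  by_contra! h
  have h12 : κ 1 < κ 2 := hκ (by decide)
  have h' : ∀ s, ∃ γ₁ γ₂ : ℝ, γ₁ < γ₂ ∧ (γ = γ₁ ∨ γ = γ₂) ∧
      ∀ l, (dressedPhase κ A l s < 0 ↔ γ₁ < κ l ∧ κ l < γ₂) ∧
        (dressedPhase κ A l s = 0 ↔ γ₁ = κ l ∨ γ₂ = κ l) ∧
        (0 < dressedPhase κ A l s ↔ κ l < γ₁ ∨ γ₂ < κ l) := fun s => by
    obtain ⟨γ₁, γ₂, -, hlt, -, h1, h2⟩ := exists_sato_roots hκ hA s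
    refine ⟨γ₁, γ₂, hlt, ?_, roots_of_dressedPhase h1 h2 hlt⟩
    have := (satoPoly_eval_eq_zero_iff h1 h2 _).1 (h s)
    exact_mod_cast this
  obtain ⟨s, p1, p2⟩ := exists_one_neg_two_pos hκ hA
  obtain ⟨s', q1, q2⟩ := exists_one_neg_two_neg hκ hA
  obtain ⟨s'', r1, r2⟩ := exists_one_pos_two_neg hκ hA
  obtain ⟨a, b, hab, hγ, hs⟩ := h' s
  obtain ⟨a', b', hab', hγ', hs'⟩ := h' s'
  obtain ⟨a'', b'', hab'', hγ'', hs''⟩ := h' s''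
  rw [(hs 1).1] at p1
  rw [(hs 2).2.2] at p2
  rw [(hs' 1).1] at q1
  rw [(hs' 2).1] at q2
  rw [(hs'' 1).2.2] at r1
  rw [(hs'' 2).1] at r2
  grind

variable (κ A) in
/-- The normalized wavefunction, glued from the Sato wavefunction and its values at the nodes. -/
noncomputable def normalizedWave (w : Weights) (s₀ : Time) : Wave := fun s c p =>
  match c with
  | .gamma0 => p.elim ∞ (exists_sato_extension κ A s₀ s).choose
  | .gamma13 => mobiusWave (dressedWave κ A w .white13_black24 s)
      (dressedWave κ A w .white13_black23 s) (dressedWave κ A w .white13_black24 s₀)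
      (dressedWave κ A w .white13_black23 s₀) p
  | .gamma23 => mobiusWave (dressedWave κ A w .white23_black24 s)
      (dressedWave κ A w .white23_b3 s) (dressedWave κ A w .white23_black24 s₀)
      (dressedWave κ A w .white23_b3 s₀) p
  | .sigma23 => rpt (dressedPhase κ A 1 s / dressedPhase κ A 1 s₀)
  | .sigma24 => rpt (dressedPhase κ A 3 s / dressedPhase κ A 3 s₀)

/-- The dressed edge wavefunctions on the edges that end at the black vertices, at the sinks, and at
the first source. -/
theorem dressedWave_boundary (hκ : StrictMono κ) (hA : IsTotallyPositive A) {w : Weights}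
    (hw : w.Represents A) (s : Time) :
    dressedWave κ A w .b1_white13 s = dressedPhase κ A 0 s ∧
    dressedWave κ A w .b2_black23 s = -dressedPhase κ A 1 s ∧
    w.w23 * dressedWave κ A w .black23_white23 s = -dressedPhase κ A 1 s ∧
    dressedWave κ A w .black24_b4 s = dressedPhase κ A 3 s := by
  obtain ⟨h0, h1⟩ := hw.dressedPhase_relations hκ hA s
  simp only [dressedWave_eq, Edge.coeff, Fin.sum_univ_four, h0, h1, Matrix.cons_val]
  refine ⟨?_, ?_, ?_, ?_⟩ <;> ring

/-! ### Consistency of the values at the double points, existence, uniqueness and poles -/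

variable {s₀ : Time} {w : Weights}

/-- The index of the dressed exponential to which the dressed wavefunction of an edge is
proportional. -/
def Edge.phase : Edge → Fin 4
  | .b1_white13 => 0
  | .b2_black23 | .white13_black23 | .black23_white23 => 1
  | .white23_b3 => 2
  | .white13_black24 | .white23_black24 | .black24_b4 => 3

/-- The factor between Ψ_e and its D_l is a weight up to sign and inversion, hence independent of
time, and cancels. All edges at V'₂₃ have index 1 and all at V'₂₄ index 3, which is why constants on
Σ₂₃ and Σ₂₄ can be glued. -/
theorem dressedWave_ratio (hκ : StrictMono κ) (hA : IsTotallyPositive A)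
    (hw : w.Represents A) (s s₀ : Time) (e : Edge) :
    dressedWave κ A w e s / dressedWave κ A w e s₀ =
      dressedPhase κ A e.phase s / dressedPhase κ A e.phase s₀ := by
  obtain ⟨⟨-, w14, w23, w24⟩, -⟩ := id hw
  have h := dressedWave_boundary hκ hA hw
  have h' := dressedWave_white (κ := κ) (A := A) w
  have hb : ∀ s, dressedWave κ A w .white13_black23 s =
      dressedWave κ A w .black23_white23 s := fun s => by
    simp [dressedWave_eq, Edge.coeff]
  have hr : dressedWave κ A w .black23_white23 s / dressedWave κ A w .black23_white23 s₀ =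
      dressedPhase κ A 1 s / dressedPhase κ A 1 s₀ := by
    rw [← mul_div_mul_left _ _ w23.ne', (h s).2.2.1, (h s₀).2.2.1, neg_div_neg_eq]
  cases e
  · change _ = dressedPhase κ A 0 s / dressedPhase κ A 0 s₀
    rw [(h s).1, (h s₀).1]
  · change _ = dressedPhase κ A 1 s / dressedPhase κ A 1 s₀
    rw [(h s).2.1, (h s₀).2.1, neg_div_neg_eq]
  · rw [hb, hb]
    exact hr
  · change _ = dressedPhase κ A 3 s / dressedPhase κ A 3 s₀
    rw [(h' s).1, (h' s₀).1, mul_div_mul_left _ _ w14.ne']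
  · exact hr
  · change _ = dressedPhase κ A 3 s / dressedPhase κ A 3 s₀
    rw [(h' s).2.2.1, (h' s₀).2.2.1, mul_div_mul_left _ _ w24.ne']
  · change _ = dressedPhase κ A 2 s / dressedPhase κ A 2 s₀
    rw [(h' s).2.2.2, (h' s₀).2.2.2]
  · change _ = dressedPhase κ A 3 s / dressedPhase κ A 3 s₀
    rw [(h s).2.2.2, (h s₀).2.2.2]

theorem dressedWave_white_ne_zero (hκ : StrictMono κ) (hA : IsTotallyPositive A)
    (hw : w.Represents A) (hs : IsGeneric κ A s₀) :
    (dressedWave κ A w .white13_black24 s₀ : ℂ) ≠ 0 ∧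
    (dressedWave κ A w .white13_black23 s₀ : ℂ) ≠ 0 ∧
    (dressedWave κ A w .white13_black24 s₀ + dressedWave κ A w .white13_black23 s₀ : ℂ) ≠ 0 ∧
    (dressedWave κ A w .white23_black24 s₀ : ℂ) ≠ 0 ∧
    (dressedWave κ A w .white23_b3 s₀ : ℂ) ≠ 0 ∧
    (dressedWave κ A w .white23_black24 s₀ + dressedWave κ A w .white23_b3 s₀ : ℂ) ≠ 0 := by
  obtain ⟨e1, e2, e3, e4⟩ := dressedWave_white (κ := κ) (A := A) w s₀
  obtain ⟨d1, -, -, d2⟩ := hw.denominators hκ hA s₀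
  have d3 := (not_congr d2).2 (hs 1)
  rw [e1, e2, e3, e4]
  norm_cast
  refine ⟨mul_ne_zero hw.1.2.1.ne' (hs 3), d3, ?_, mul_ne_zero hw.1.2.2.2.ne' (hs 3), hs 2, ?_⟩
  · intro h
    exact d1.ne' (by linear_combination h)
  · rwa [add_comm]

theorem normalizedWave_coe (s : Time) (z : ℂ) (hz : satoWave κ A z s₀ ≠ 0) :
    normalizedWave κ A w s₀ s .gamma0 (z : OnePoint ℂ) =
      ((satoWave κ A z s / satoWave κ A z s₀ : ℂ) : OnePoint ℂ) :=
  (exists_sato_extension κ A s₀ s).choose_spec.2 z hz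

theorem normalizedWave_phase (hs : IsGeneric κ A s₀) (s : Time) (l : Fin 4) :
    normalizedWave κ A w s₀ s .gamma0 (rpt (κ l)) =
      rpt (dressedPhase κ A l s / dressedPhase κ A l s₀) := by
  rw [rpt, normalizedWave_coe, satoWave_ofReal, satoWave_ofReal, rpt, Complex.ofReal_div]
  rw [satoWave_ofReal]
  exact_mod_cast hs l

theorem coe_div (x y : ℝ) : (((x : ℂ) / (y : ℂ) : ℂ) : OnePoint ℂ) = rpt (x / y) := by
  rw [rpt, Complex.ofReal_div]

theorem coe_add_div (x y x' y' : ℝ) :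
    ((((x : ℂ) + (y : ℂ)) / ((x' : ℂ) + (y' : ℂ)) : ℂ) : OnePoint ℂ) =
      rpt ((x + y) / (x' + y')) := by
  rw [← coe_div, Complex.ofReal_add, Complex.ofReal_add]

theorem normalizedWave_white (hκ : StrictMono κ) (hA : IsTotallyPositive A)
    (hw : w.Represents A) (hs : IsGeneric κ A s₀) (s : Time) :
    normalizedWave κ A w s₀ s .gamma13 (rpt 0) =
      rpt (dressedPhase κ A 3 s / dressedPhase κ A 3 s₀) ∧
    normalizedWave κ A w s₀ s .gamma13 (rpt 1) =
      rpt (dressedPhase κ A 1 s / dressedPhase κ A 1 s₀) ∧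
    normalizedWave κ A w s₀ s .gamma13 ∞ =
      rpt (dressedPhase κ A 0 s / dressedPhase κ A 0 s₀) ∧
    normalizedWave κ A w s₀ s .gamma23 (rpt 0) =
      rpt (dressedPhase κ A 3 s / dressedPhase κ A 3 s₀) ∧
    normalizedWave κ A w s₀ s .gamma23 (rpt 1) =
      rpt (dressedPhase κ A 2 s / dressedPhase κ A 2 s₀) ∧
    normalizedWave κ A w s₀ s .gamma23 ∞ =
      rpt (dressedPhase κ A 1 s / dressedPhase κ A 1 s₀) := by
  obtain ⟨n1, n2, n3, n4, n5, n6⟩ := dressedWave_white_ne_zero hκ hA hw hs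
  have r := dressedWave_ratio hκ hA hw s s₀
  have h := fun s => (dressedWave_white (κ := κ) (A := A) w s)
  have s13 : (dressedWave κ A w .white13_black24 s + dressedWave κ A w .white13_black23 s) /
      (dressedWave κ A w .white13_black24 s₀ + dressedWave κ A w .white13_black23 s₀) =
      dressedPhase κ A 0 s / dressedPhase κ A 0 s₀ := by
    have e : ∀ s, w.w13 * (dressedWave κ A w .white13_black24 s +
        dressedWave κ A w .white13_black23 s) = dressedPhase κ A 0 s := fun s => by
      rw [(hw.dressedPhase_relations hκ hA s).1, (h s).1, (h s).2.1]
      ring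
    rw [← mul_div_mul_left _ _ hw.1.1.ne', e, e]
  have s23 : (dressedWave κ A w .white23_black24 s + dressedWave κ A w .white23_b3 s) /
      (dressedWave κ A w .white23_black24 s₀ + dressedWave κ A w .white23_b3 s₀) =
      dressedPhase κ A 1 s / dressedPhase κ A 1 s₀ := by
    have e : ∀ s, -w.w23 * (dressedWave κ A w .white23_black24 s +
        dressedWave κ A w .white23_b3 s) = dressedPhase κ A 1 s := fun s => by
      rw [(hw.dressedPhase_relations hκ hA s).2, (h s).2.2.1, (h s).2.2.2]
      ring
    rw [← mul_div_mul_left _ _ (neg_ne_zero.2 hw.1.2.2.1.ne'), e, e]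
  refine ⟨?_, ?_, ?_, ?_, ?_, ?_⟩
  · exact (mobiusWave_zero _ _ n1).trans ((coe_div _ _).trans (congrArg rpt (r .white13_black24)))
  · exact (mobiusWave_one _ _ n1 n2).trans ((coe_div _ _).trans (congrArg rpt (r .white13_black23)))
  · exact (mobiusWave_infty _ _ n1 n3).trans ((coe_add_div _ _ _ _).trans (congrArg rpt s13))
  · exact (mobiusWave_zero _ _ n4).trans ((coe_div _ _).trans (congrArg rpt (r .white23_black24)))
  · exact (mobiusWave_one _ _ n4 n5).trans ((coe_div _ _).trans (congrArg rpt (r .white23_b3)))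
  · exact (mobiusWave_infty _ _ n4 n6).trans ((coe_add_div _ _ _ _).trans (congrArg rpt s23))

theorem isKPWave_normalizedWave (hκ : StrictMono κ) (hA : IsTotallyPositive A)
    (hw : w.Represents A) (hs : IsGeneric κ A s₀) :
    IsKPWave κ A s₀ (normalizedWave κ A w s₀) where
  sato s z hz := normalizedWave_coe s z hz
  sato_continuous s := (exists_sato_extension κ A s₀ s).choose_spec.1
  black23 s := ⟨_, fun _ => rfl⟩
  black24 s := ⟨_, fun _ => rfl⟩
  white13 s := isMeromorphicDegLeOne_mobiusWave _ _ _ _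
  white23 s := isMeromorphicDegLeOne_mobiusWave _ _ _ _
  glue s e := by
    obtain ⟨a0, a1, ai, b0, b1, bi⟩ := normalizedWave_white hκ hA hw hs s
    cases e
    · exact (normalizedWave_phase hs s 0).trans ai.symm
    · exact normalizedWave_phase hs s 1
    · exact a1
    · exact a0
    · exact bi
    · exact b0
    · exact (normalizedWave_phase hs s 2).trans b1.symm
    · exact normalizedWave_phase hs s 3

theorem normalizedWave_node (hκ : StrictMono κ) (hA : IsTotallyPositive A)
    (hw : w.Represents A) (hs : IsGeneric κ A s₀) (s : Time) (e : Edge) :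
    normalizedWave κ A w s₀ s (node κ e).1.1 (node κ e).1.2 =
      rpt (dressedWave κ A w e s / dressedWave κ A w e s₀) := by
  obtain ⟨a0, a1, ai, b0, b1, bi⟩ := normalizedWave_white hκ hA hw hs s
  rw [dressedWave_ratio hκ hA hw]
  cases e
  · exact normalizedWave_phase hs s 0
  · exact normalizedWave_phase hs s 1
  · exact a1
  · exact a0
  · exact bi
  · exact b0
  · exact normalizedWave_phase hs s 2
  · exact normalizedWave_phase hs s 3

/-- On Γ₀ continuity extends the prescribed values from a dense set. The nodes at κ 1 and κ 3 then
fix the constants on Σ₂₃ and Σ₂₄, and each white component has its values at 0, 1, ∞ prescribed. -/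
theorem IsKPWave.eq_of_ne_P0 {ψ ψ' : Wave}
    (hψ : IsKPWave κ A s₀ ψ) (hψ' : IsKPWave κ A s₀ ψ') (s : Time) (p : Point) (hp : p ≠ P0) :
    ψ' s p.1 p.2 = ψ s p.1 p.2 := by
  have h0 : (fun z : ℂ => ψ' s .gamma0 (z : OnePoint ℂ)) = fun z : ℂ => ψ s .gamma0 z :=
    Continuous.ext_on (dense_satoWave_ne_zero s₀) (hψ'.sato_continuous s)
      (hψ.sato_continuous s) fun z hz => (hψ'.sato s z hz).trans (hψ.sato s z hz).symm
  have hk : ∀ l, ψ' s .gamma0 (rpt (κ l)) = ψ s .gamma0 (rpt (κ l)) := fun l => congrFun h0 (κ l)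
  have g := hψ.glue s
  have g' := hψ'.glue s
  have h23 : ∀ z, ψ' s .sigma23 z = ψ s .sigma23 z := fun z => by
    obtain ⟨c, hc⟩ := hψ.black23 s
    obtain ⟨c', hc'⟩ := hψ'.black23 s
    rw [hc, hc', ← hc ∞, ← hc' ∞]
    exact (g' .b2_black23).symm.trans ((hk 1).trans (g .b2_black23))
  have h24 : ∀ z, ψ' s .sigma24 z = ψ s .sigma24 z := fun z => by
    obtain ⟨c, hc⟩ := hψ.black24 s
    obtain ⟨c', hc'⟩ := hψ'.black24 s
    rw [hc, hc', ← hc ∞, ← hc' ∞]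
    exact (g' .black24_b4).symm.trans ((hk 3).trans (g .black24_b4))
  have w13 : ψ' s .gamma13 = ψ s .gamma13 := (hψ'.white13 s).ext (hψ.white13 s)
    ((g' .white13_black24).trans ((h24 _).trans (g .white13_black24).symm))
    ((g' .white13_black23).trans ((h23 _).trans (g .white13_black23).symm))
    ((g' .b1_white13).symm.trans ((hk 0).trans (g .b1_white13)))
  have w23 : ψ' s .gamma23 = ψ s .gamma23 := (hψ'.white23 s).ext (hψ.white23 s)
    ((g' .white23_black24).trans ((h24 _).trans (g .white23_black24).symm))
    ((g' .white23_b3).symm.trans ((hk 2).trans (g .white23_b3)))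
    ((g' .black23_white23).trans ((h23 _).trans (g .black23_white23).symm))
  obtain ⟨c, z⟩ := p
  cases c with
  | gamma0 =>
    cases z with
    | infty => exact absurd rfl hp
    | coe z => exact congrFun h0 z
  | gamma13 => exact congrFun w13 z
  | gamma23 => exact congrFun w23 z
  | sigma23 => exact h23 z
  | sigma24 => exact h24 z

theorem isPoleDivisor_normalizedWave (hκ : StrictMono κ) (hA : IsTotallyPositive A)
    (hw : w.Represents A) (hs : IsGeneric κ A s₀) :
    IsPoleDivisor (normalizedWave κ A w s₀) (kpDivisor κ A w s₀) := by
  obtain ⟨γ₁, γ₂, -, hlt, -, h1, h2⟩ := exists_sato_roots hκ hA s₀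
  obtain ⟨n1, n2, n3, n4, n5, n6⟩ := dressedWave_white_ne_zero hκ hA hw hs
  have hψ := isKPWave_normalizedWave hκ hA hw hs
  have hdiv : ∀ a b : ℝ, (a + b : ℂ) ≠ 0 →
      divisorNumber a b = ((a / (a + b) : ℂ) : OnePoint ℂ) := fun a b hab => by
    rw [divisorNumber, if_neg (by exact_mod_cast hab), rpt]
    push_cast
    rfl
  have hD : kpDivisor κ A w s₀ = {(Comp.gamma0, rpt γ₁), (Comp.gamma0, rpt γ₂),
      (Comp.gamma13, divisorNumber (dressedWave κ A w .white13_black24 s₀)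
        (dressedWave κ A w .white13_black23 s₀)),
      (Comp.gamma23, divisorNumber (dressedWave κ A w .white23_black24 s₀)
        (dressedWave κ A w .white23_b3 s₀))} := by
    rw [kpDivisor_eq hκ hA hw h1 h2]
    obtain ⟨e1, e2, e3, e4⟩ := dressedWave_white (κ := κ) (A := A) w s₀
    have hsum : w.w14 * dressedPhase κ A 3 s₀ +
        (dressedPhase κ A 2 s₀ + w.w24 * dressedPhase κ A 3 s₀) =
        dressedPhase κ A 2 s₀ + (w.w14 + w.w24) * dressedPhase κ A 3 s₀ := by ring
    rw [e1, e2, e3, e4, divisorNumber.eq_1 (w.w14 * _), hsum,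
      if_neg (hw.denominators hκ hA s₀).1.ne']
  rw [hdiv _ _ n3, hdiv _ _ n6] at hD
  have hmem : ∀ p, p ∈ kpDivisor κ A w s₀ ↔ p = (Comp.gamma0, rpt γ₁) ∨
      p = (Comp.gamma0, rpt γ₂) ∨ p = (Comp.gamma13, _) ∨ p = (Comp.gamma23, _) := fun p => by
    rw [hD]
    simp only [Multiset.insert_eq_cons, Multiset.mem_cons, Multiset.mem_singleton]
    exact Iff.rfl
  have o0 := hψ.orderAt_gamma0 h1 h2 hlt.ne
  have hinj : rpt γ₁ ≠ rpt γ₂ := fun h => hlt.ne (rpt_injective h)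
  refine isPoleDivisor_of_simple ?_ ?_ ?_ ?_ ?_
  · rw [hD]
    simp [hinj]
  · rw [hmem]
    simp [P0, (rpt_ne_infty _).symm]
  · rintro s ⟨c, z⟩ hp hpD
    rw [hmem] at hpD
    simp only [Prod.mk.injEq, not_or, not_and] at hpD
    obtain ⟨m1, m2, m3, m4⟩ := hpD
    cases c with
    | gamma0 =>
      cases z with
      | infty => exact absurd rfl hp
      | coe z =>
        exact (o0 s z).1 (fun h => m1 rfl (congrArg _ h)) (fun h => m2 rfl (congrArg _ h))
    | gamma13 => exact orderAt_mobiusWave_nonneg _ _ n1 n3 (m3 rfl)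
    | gamma23 => exact orderAt_mobiusWave_nonneg _ _ n4 n6 (m4 rfl)
    | sigma23 => exact orderAt_const _ _ (fun _ => rfl) _
    | sigma24 => exact orderAt_const _ _ (fun _ => rfl) _
  · intro s p hp
    rw [hmem] at hp
    rcases hp with rfl | rfl | rfl | rfl
    · exact ((o0 s γ₁).2 (Or.inl rfl)).1
    · exact ((o0 s γ₂).2 (Or.inr rfl)).1
    · exact (orderAt_mobiusWave_pole _ _ n1 n3).1
    · exact (orderAt_mobiusWave_pole _ _ n4 n6).1
  · intro p hp
    obtain ⟨sn, p1, p2⟩ := exists_one_neg_two_pos hκ hA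
    obtain ⟨sp, q1, q2⟩ := exists_one_pos_two_neg hκ hA
    have d3 := dressedPhase_three_pos hκ hA
    have dw := fun s => dressedWave_white (κ := κ) (A := A) w s
    have hd := hw.denominators hκ hA
    rw [hmem] at hp
    rcases hp with rfl | rfl | rfl | rfl
    · obtain ⟨s, hs⟩ := exists_satoPoly_eval_ne_zero hκ hA γ₁
      exact ⟨s, ((o0 s γ₁).2 (Or.inl rfl)).2 hs⟩
    · obtain ⟨s, hs⟩ := exists_satoPoly_eval_ne_zero hκ hA γ₂
      exact ⟨s, ((o0 s γ₂).2 (Or.inr rfl)).2 hs⟩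
    -- The Möbius determinant is nonzero at any time where D_1 has the sign opposite to its sign at
    -- `s₀`: since D_3 > 0, both summands then have the same sign. On Γ₂₃ the sign of D_2 plays this
    -- role.
    · have : ∃ s, dressedWave κ A w .white13_black24 s * dressedWave κ A w .white13_black23 s₀ -
          dressedWave κ A w .white13_black23 s * dressedWave κ A w .white13_black24 s₀ ≠ 0 := by
        simp only [dw]
        rcases (hs 1).lt_or_gt with h | h
        · refine ⟨sp, ne_of_gt ?_⟩
          have a1 := mul_pos (mul_pos hw.1.2.1 (d3 sp)) ((hd s₀).2.1.2 h)
          have a2 := mul_neg_of_neg_of_pos ((hd sp).2.2.1.2 q1) (mul_pos hw.1.2.1 (d3 s₀))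
          linarith
        · refine ⟨sn, ne_of_lt ?_⟩
          have a1 := mul_neg_of_pos_of_neg (mul_pos hw.1.2.1 (d3 sn)) ((hd s₀).2.2.1.2 h)
          have a2 := mul_pos ((hd sn).2.1.2 p1) (mul_pos hw.1.2.1 (d3 s₀))
          linarith
      obtain ⟨s, hs⟩ := this
      exact ⟨s, (orderAt_mobiusWave_pole _ _ n1 n3).2 (by exact_mod_cast hs)⟩
    · have : ∃ s, dressedWave κ A w .white23_black24 s * dressedWave κ A w .white23_b3 s₀ -
          dressedWave κ A w .white23_b3 s * dressedWave κ A w .white23_black24 s₀ ≠ 0 := by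
        simp only [dw]
        rcases (hs 2).lt_or_gt with h | h
        · refine ⟨sn, ne_of_lt ?_⟩
          have a1 := mul_neg_of_pos_of_neg (mul_pos hw.1.2.2.2 (d3 sn)) h
          have a2 := mul_pos p2 (mul_pos hw.1.2.2.2 (d3 s₀))
          linarith
        · refine ⟨sp, ne_of_gt ?_⟩
          have a1 := mul_pos (mul_pos hw.1.2.2.2 (d3 sp)) h
          have a2 := mul_neg_of_neg_of_pos q2 (mul_pos hw.1.2.2.2 (d3 s₀))
          linarith
      obtain ⟨s, hs⟩ := this
      exact ⟨s, (orderAt_mobiusWave_pole _ _ n4 n6).2 (by exact_mod_cast hs)⟩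

end NormalizedWave

/-! ### Configurations of the divisor points -/

section Configurations

variable {κ : Fin 4 → ℝ} {A : Matrix (Fin 2) (Fin 4) ℝ}

/-- The positions of the divisor points for each of the possible sign patterns. -/
theorem divisor_configurations (hκ : StrictMono κ) (hA : IsTotallyPositive A) {w : Weights}
    (hw : w.Represents A) {γ₁ γ₂ : ℝ} {s : Time} (hlt : γ₁ < γ₂)
    (h1 : γ₁ + γ₂ = coeff1 κ A s) (h2 : γ₁ * γ₂ = -coeff2 κ A s)
    {p : ℝ} (hp : p = w.w14 * dressedPhase κ A 3 s /
      (dressedPhase κ A 2 s + (w.w14 + w.w24) * dressedPhase κ A 3 s))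
    {p' : OnePoint ℂ}
    (hp' : p' = divisorNumber (w.w24 * dressedPhase κ A 3 s) (dressedPhase κ A 2 s)) :
    (dressedPhase κ A 1 s < 0 ∧ 0 < dressedPhase κ A 2 s ∧ γ₁ < κ 1 ∧ κ 1 < γ₂ ∧ γ₂ < κ 2 ∧
      0 < p ∧ p < 1 ∧ ∃ q, p' = rpt q ∧ 0 < q ∧ q < 1) ∨
    (dressedPhase κ A 1 s < 0 ∧ dressedPhase κ A 2 s < 0 ∧ γ₁ < κ 1 ∧ κ 2 < γ₂ ∧
      0 < p ∧ p < 1 ∧ ∃ q, p' = rpt q ∧ 1 < q) ∨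
    (0 < dressedPhase κ A 1 s ∧ dressedPhase κ A 2 s < 0 ∧ κ 1 < γ₁ ∧ γ₁ < κ 2 ∧ κ 2 < γ₂ ∧
      1 < p ∧ ∃ q, p' = rpt q ∧ q < 0) ∨
    (dressedPhase κ A 1 s = 0 ∧ dressedPhase κ A 2 s < 0 ∧ γ₁ = κ 1 ∧ κ 2 < γ₂ ∧
      p = 1 ∧ p' = ∞) ∨
    (dressedPhase κ A 1 s < 0 ∧ dressedPhase κ A 2 s = 0 ∧ γ₁ < κ 1 ∧ γ₂ = κ 2 ∧
      0 < p ∧ p < 1 ∧ p' = rpt 1) := by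
  have h12 : κ 1 < κ 2 := hκ (by decide)
  obtain ⟨dN, dpos, dneg, dzero⟩ := hw.denominators hκ hA s
  obtain ⟨r1n, r1z, r1p⟩ := roots_of_dressedPhase h1 h2 hlt 1
  obtain ⟨r2n, r2z, r2p⟩ := roots_of_dressedPhase h1 h2 hlt 2
  have d3 := dressedPhase_three_pos hκ hA s
  have a3 := mul_pos hw.1.2.1 d3
  have b3 := mul_pos hw.1.2.2.2 d3
  -- In this form `p` is α/(α + β) with α > 0 and β of the sign of -D_1, so p is below, at or above
  -- 1 according to the sign of D_1.
  have e : dressedPhase κ A 2 s + (w.w14 + w.w24) * dressedPhase κ A 3 s =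
      w.w14 * dressedPhase κ A 3 s +
        (dressedPhase κ A 2 s + w.w24 * dressedPhase κ A 3 s) := by ring
  rw [e] at hp dN
  have hp0 : 0 < p := hp ▸ div_pos a3 dN
  rw [divisorNumber, add_comm] at hp'
  generalize hd1 : dressedPhase κ A 1 s = d1 at *
  generalize hd2 : dressedPhase κ A 2 s = d2 at *
  generalize hd3 : dressedPhase κ A 3 s = d3 at *
  rcases lt_trichotomy d1 0 with c1 | c1 | c1
  · have f := dpos.2 c1
    have hp1 : p < 1 := by
      rw [hp, div_lt_one dN]
      linarith
    rw [if_neg f.ne'] at hp'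
    obtain ⟨k1, k2⟩ := r1n.1 c1
    rcases lt_trichotomy d2 0 with c2 | c2 | c2
    · refine Or.inr (Or.inl ⟨c1, c2, k1, (r2n.1 c2).2, hp0, hp1, _, hp', ?_⟩)
      rw [one_lt_div f]
      linarith
    · refine Or.inr (Or.inr (Or.inr (Or.inr ⟨c1, c2, k1, ?_, hp0, hp1, ?_⟩)))
      · rcases r2z.1 c2 with h | h
        · linarith
        · exact h
      · rw [hp', c2, zero_add, div_self b3.ne']
    · refine Or.inl ⟨c1, c2, k1, k2, ?_, hp0, hp1, _, hp', div_pos b3 f, ?_⟩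
      · rcases r2p.1 c2 with h | h
        · linarith
        · exact h
      · rw [div_lt_one f]
        linarith
  · have f := dzero.2 c1
    have c2 : d2 < 0 := by linarith
    obtain ⟨k1, k2⟩ := r2n.1 c2
    refine Or.inr (Or.inr (Or.inr (Or.inl ⟨c1, c2, ?_, k2, ?_, ?_⟩)))
    · rcases r1z.1 c1 with h | h
      · exact h
      · linarith
    · rw [hp, f, add_zero, div_self a3.ne']
    · rw [hp', if_pos f]
  · have f := dneg.2 c1
    -- Here D_2 < -w24 D_3 < 0, so D_1 and D_2 are never both positive.
    have c2 : d2 < 0 := by linarith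
    obtain ⟨k1, k2⟩ := r2n.1 c2
    rw [if_neg f.ne] at hp'
    refine Or.inr (Or.inr (Or.inl ⟨c1, c2, ?_, k1, k2, ?_, _, hp', div_neg_of_pos_of_neg b3 f⟩))
    · rcases r1p.1 c1 with h | h
      · exact h
      · linarith
    · rw [hp, one_lt_div dN]
      linarith

/-- The three assignments of points to ovals are those of the generic configurations. Membership in
several ovals is harmless here, so divisor points at double points are covered too. -/
theorem exists_matching {D : Multiset Point} {a b c d : Point} {S : Fin 4 → Set Point}
    (hD : D = {a, b, c, d})
    (h : (a ∈ S 0 ∧ b ∈ S 1 ∧ d ∈ S 2 ∧ c ∈ S 3) ∨ (a ∈ S 0 ∧ d ∈ S 1 ∧ b ∈ S 2 ∧ c ∈ S 3) ∨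
      (c ∈ S 0 ∧ a ∈ S 1 ∧ b ∈ S 2 ∧ d ∈ S 3)) :
    ∃ P : Fin 4 → Point, (∀ j, P j ∈ S j) ∧ D = Finset.univ.val.map P := by
  have hP : ∀ a b c d : Point, Finset.univ.val.map ![a, b, c, d] = {a, b, c, d} :=
    fun _ _ _ _ => rfl
  rcases h with h | h | h
  · refine ⟨![a, b, d, c], ?_, ?_⟩
    · simpa [Fin.forall_fin_succ] using h
    · rw [hP, hD]
      simp only [Multiset.insert_eq_cons, ← Multiset.singleton_add]
      abel
  · refine ⟨![a, d, b, c], ?_, ?_⟩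
    · simpa [Fin.forall_fin_succ] using h
    · rw [hP, hD]
      simp only [Multiset.insert_eq_cons, ← Multiset.singleton_add]
      abel
  · refine ⟨![c, a, b, d], ?_, ?_⟩
    · simpa [Fin.forall_fin_succ] using h
    · rw [hP, hD]
      simp only [Multiset.insert_eq_cons, ← Multiset.singleton_add]
      abel

end Configurations

end KPGr24

/-! ### Assembly of the theorem -/

open Classical in
theorem mainTheorem2 (κ : Fin 4 → ℝ) (hκ : StrictMono κ)
    (A : Matrix (Fin 2) (Fin 4) ℝ) (hA : IsTotallyPositive A) :
    -- the dressing operator is well defined and annihilates the heat solutions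
    (∀ (s : Time) (a b : ℝ),
      (∀ i, dx (dx (heatSol κ A i)) s = a * dx (heatSol κ A i) s + b * heatSol κ A i s) ↔
        a = coeff1 κ A s ∧ b = coeff2 κ A s) ∧
    (∀ i s, darboux κ A (heatSol κ A i) s = 0) ∧
    -- signs of the first and the last dressed exponential
    (∀ s, 0 < dressedPhase κ A 0 s ∧ 0 < dressedPhase κ A 3 s) ∧
    -- generic initial times form an open dense set
    (IsOpen {s | IsGeneric κ A s} ∧ Dense {s | IsGeneric κ A s}) ∧
    -- each of the three generic sign patterns occurs
    ((∃ s, dressedPhase κ A 1 s < 0 ∧ 0 < dressedPhase κ A 2 s) ∧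
      (∃ s, dressedPhase κ A 1 s < 0 ∧ dressedPhase κ A 2 s < 0) ∧
      (∃ s, 0 < dressedPhase κ A 1 s ∧ dressedPhase κ A 2 s < 0)) ∧
    -- the weights are determined by the point of the Grassmannian
    (∃! w : Weights, w.Represents A) ∧
    ∀ w : Weights, w.Represents A → ∀ s₀ : Time, ∃ (γ₁ γ₂ p13 : ℝ) (p23 : OnePoint ℂ),
      -- the four divisor points and their coordinates
      kpDivisor κ A w s₀ = {(Comp.gamma0, rpt γ₁), (Comp.gamma0, rpt γ₂),
        (Comp.gamma13, rpt p13), (Comp.gamma23, p23)} ∧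
      (κ 0 ≤ γ₁ ∧ γ₁ < γ₂ ∧ γ₂ ≤ κ 3) ∧
      γ₁ + γ₂ = coeff1 κ A s₀ ∧ γ₁ * γ₂ = -coeff2 κ A s₀ ∧
      0 < dressedPhase κ A 2 s₀ + (w.w14 + w.w24) * dressedPhase κ A 3 s₀ ∧
      p13 = w.w14 * dressedPhase κ A 3 s₀ /
        (dressedPhase κ A 2 s₀ + (w.w14 + w.w24) * dressedPhase κ A 3 s₀) ∧
      (dressedPhase κ A 2 s₀ + w.w24 * dressedPhase κ A 3 s₀ = 0 ↔ dressedPhase κ A 1 s₀ = 0) ∧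
      (dressedPhase κ A 1 s₀ ≠ 0 →
        p23 = rpt (w.w24 * dressedPhase κ A 3 s₀ /
          (dressedPhase κ A 2 s₀ + w.w24 * dressedPhase κ A 3 s₀))) ∧
      (dressedPhase κ A 1 s₀ = 0 → p23 = ∞) ∧
      -- for generic data these points are the poles of the normalized wavefunction
      (IsGeneric κ A s₀ → ∃ ψ : Wave, IsKPWave κ A s₀ ψ ∧
        (∀ ψ' : Wave, IsKPWave κ A s₀ ψ' →
          ∀ (s : Time) (p : Point), p ≠ P0 → ψ' s p.1 p.2 = ψ s p.1 p.2) ∧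
        (∀ (s : Time) (e : Edge), ψ s (node κ e).1.1 (node κ e).1.2 =
          rpt (dressedWave κ A w e s / dressedWave κ A w e s₀)) ∧
        IsPoleDivisor ψ (kpDivisor κ A w s₀)) ∧
      -- for generic data each finite oval contains exactly one divisor point, and the
      -- configuration is one of three, fixed by two signs
      (IsGeneric κ A s₀ →
        (∀ j, ((kpDivisor κ A w s₀).filter (· ∈ finiteOval κ j)).card = 1) ∧
        ((dressedPhase κ A 1 s₀ < 0 ∧ 0 < dressedPhase κ A 2 s₀ ∧
            (Comp.gamma0, rpt γ₁) ∈ finiteOval κ 0 ∧ (Comp.gamma0, rpt γ₂) ∈ finiteOval κ 1 ∧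
            (Comp.gamma13, rpt p13) ∈ finiteOval κ 3 ∧ (Comp.gamma23, p23) ∈ finiteOval κ 2) ∨
          (dressedPhase κ A 1 s₀ < 0 ∧ dressedPhase κ A 2 s₀ < 0 ∧
            (Comp.gamma0, rpt γ₁) ∈ finiteOval κ 0 ∧ (Comp.gamma0, rpt γ₂) ∈ finiteOval κ 2 ∧
            (Comp.gamma13, rpt p13) ∈ finiteOval κ 3 ∧ (Comp.gamma23, p23) ∈ finiteOval κ 1) ∨
          (0 < dressedPhase κ A 1 s₀ ∧ dressedPhase κ A 2 s₀ < 0 ∧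
            (Comp.gamma0, rpt γ₁) ∈ finiteOval κ 1 ∧ (Comp.gamma0, rpt γ₂) ∈ finiteOval κ 2 ∧
            (Comp.gamma13, rpt p13) ∈ finiteOval κ 0 ∧
            (Comp.gamma23, p23) ∈ finiteOval κ 3))) ∧
      -- non-generic data: divisor points at double points
      (dressedPhase κ A 1 s₀ = 0 →
        γ₁ = κ 1 ∧ κ 2 < γ₂ ∧ γ₂ < κ 3 ∧ p13 = 1 ∧ p23 = ∞) ∧
      (dressedPhase κ A 2 s₀ = 0 →
        κ 0 < γ₁ ∧ γ₁ < κ 1 ∧ γ₂ = κ 2 ∧ 0 < p13 ∧ p13 < 1 ∧ p23 = rpt 1) ∧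
      -- for all data: the infinite oval contains the essential singularity and no divisor point,
      -- and each finite oval has exactly one divisor point, where a divisor point at a double
      -- point is counted in one of the ovals that meet there
      P0 ∈ infiniteOval κ ∧ (∀ p ∈ kpDivisor κ A w s₀, p ∉ infiniteOval κ) ∧
      (∃ P : Fin 4 → Point, (∀ j, P j ∈ finiteOval κ j) ∧
        kpDivisor κ A w s₀ = Finset.univ.val.map P) := by
  refine ⟨darboux_coeff_unique hκ hA, darboux_heatSol hκ hA,
    fun s => ⟨dressedPhase_zero_pos hκ hA s, dressedPhase_three_pos hκ hA s⟩,
    ⟨isOpen_isGeneric hκ hA, dense_isGeneric hκ hA⟩,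
    ⟨exists_one_neg_two_pos hκ hA, exists_one_neg_two_neg hκ hA, exists_one_pos_two_neg hκ hA⟩,
    existsUnique_weights hA, fun w hw s₀ => ?_⟩
  have h01 : κ 0 < κ 1 := hκ (by decide)
  have h12 : κ 1 < κ 2 := hκ (by decide)
  have h23 : κ 2 < κ 3 := hκ (by decide)
  obtain ⟨γ₁, γ₂, hl, hlt, hr, h1, h2⟩ := exists_sato_roots hκ hA s₀
  obtain ⟨dN, -, -, dzero⟩ := hw.denominators hκ hA s₀
  obtain ⟨p, hp⟩ : ∃ p, p = w.w14 * dressedPhase κ A 3 s₀ /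
    (dressedPhase κ A 2 s₀ + (w.w14 + w.w24) * dressedPhase κ A 3 s₀) := ⟨_, rfl⟩
  obtain ⟨p', hp'⟩ : ∃ p', p' = divisorNumber (w.w24 * dressedPhase κ A 3 s₀)
    (dressedPhase κ A 2 s₀) := ⟨_, rfl⟩
  have hD := kpDivisor_eq hκ hA hw h1 h2
  rw [← hp, ← hp'] at hD
  have hconf := divisor_configurations hκ hA hw hlt h1 h2 hp hp'
  have hp0 : 0 < p := hp ▸ div_pos (mul_pos hw.1.2.1 (dressedPhase_three_pos hκ hA s₀)) dN
  refine ⟨γ₁, γ₂, p, p', hD, ⟨hl.le, hlt, hr.le⟩, h1, h2, dN, hp, dzero, fun h => ?_, fun h => ?_,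
    fun hs => ?_, fun hs => ⟨?_, ?_⟩, fun h => ?_, fun h => ?_, P0_mem_infiniteOval κ, ?_, ?_⟩
  · rw [hp', divisorNumber, add_comm, if_neg ((not_congr dzero).2 h)]
  · rw [hp', divisorNumber, add_comm, if_pos (dzero.2 h)]
  · exact ⟨normalizedWave κ A w s₀, isKPWave_normalizedWave hκ hA hw hs,
      fun ψ' hψ' => (isKPWave_normalizedWave hκ hA hw hs).eq_of_ne_P0 hψ',
      normalizedWave_node hκ hA hw hs, isPoleDivisor_normalizedWave hκ hA hw hs⟩
  · rcases hconf with ⟨c1, c2, a, b, c, d, e, q, rfl, f, g⟩ | ⟨c1, c2, a, b, d, e, q, rfl, f⟩ |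
      ⟨c1, c2, a, b, c, d, q, rfl, f⟩ | ⟨c1, -⟩ | ⟨-, c2, -⟩
    · exact card_filter_finiteOval hD hκ (Or.inl ⟨hl, a, b, c, d, e, f, g⟩)
    · exact card_filter_finiteOval hD hκ (Or.inr (Or.inl ⟨hl, a, b, hr, d, e, f⟩))
    · exact card_filter_finiteOval hD hκ (Or.inr (Or.inr ⟨a, b, c, hr, d, f⟩))
    · exact absurd c1 (hs 1)
    · exact absurd c2 (hs 2)
  · simp only [gamma0_mem_finiteOval, gamma13_mem_finiteOval]
    rcases hconf with ⟨c1, c2, a, b, c, d, e, q, rfl, f, g⟩ | ⟨c1, c2, a, b, d, e, q, rfl, f⟩ |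
      ⟨c1, c2, a, b, c, d, q, rfl, f⟩ | ⟨c1, -⟩ | ⟨-, c2, -⟩
    · exact Or.inl ⟨c1, c2, ⟨hl.le, a.le⟩, ⟨b.le, c.le⟩, ⟨d.le, e.le⟩,
        (gamma23_mem_finiteOval κ q).2.2.1.2 ⟨f.le, g.le⟩⟩
    · exact Or.inr (Or.inl ⟨c1, c2, ⟨hl.le, a.le⟩, ⟨b.le, hr.le⟩, ⟨d.le, e.le⟩,
        (gamma23_mem_finiteOval κ q).2.1.2 f.le⟩)
    · exact Or.inr (Or.inr ⟨c1, c2, ⟨a.le, b.le⟩, ⟨c.le, hr.le⟩, d.le,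
        (gamma23_mem_finiteOval κ q).2.2.2.2 f.le⟩)
    · exact absurd c1 (hs 1)
    · exact absurd c2 (hs 2)
  · rcases hconf with ⟨c1, -⟩ | ⟨c1, -⟩ | ⟨c1, -⟩ | ⟨-, -, a, b, c, d⟩ | ⟨c1, -⟩
    · exact absurd h c1.ne
    · exact absurd h c1.ne
    · exact absurd h c1.ne'
    · exact ⟨a, b, hr, c, d⟩
    · exact absurd h c1.ne
  · rcases hconf with ⟨-, c2, -⟩ | ⟨-, c2, -⟩ | ⟨-, c2, -⟩ | ⟨-, c2, -⟩ | ⟨-, -, a, b, c, d, e⟩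
    · exact absurd h c2.ne'
    · exact absurd h c2.ne
    · exact absurd h c2.ne
    · exact absurd h c2.ne
    · exact ⟨hl, a, b, c, d, e⟩
  · intro x hx
    rw [hD] at hx
    simp only [Multiset.insert_eq_cons, Multiset.mem_cons, Multiset.mem_singleton] at hx
    rcases hx with rfl | rfl | rfl | rfl
    · rw [gamma0_mem_infiniteOval]
      exact not_or.2 ⟨hl.not_ge, (hlt.trans hr).not_ge⟩
    · rw [gamma0_mem_infiniteOval]
      exact not_or.2 ⟨(hl.trans hlt).not_ge, hr.not_ge⟩
    · rw [gamma13_mem_infiniteOval]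
      exact hp0.not_ge
    · exact gamma23_notMem_infiniteOval κ _
  · refine exists_matching hD ?_
    simp only [gamma0_mem_finiteOval, gamma13_mem_finiteOval]
    rcases hconf with ⟨-, -, a, b, c, d, e, q, rfl, f, g⟩ | ⟨-, -, a, b, d, e, q, rfl, f⟩ |
      ⟨-, -, a, b, c, d, q, rfl, f⟩ | ⟨-, -, rfl, b, rfl, rfl⟩ | ⟨-, -, a, rfl, d, e, rfl⟩
    · exact Or.inl ⟨⟨hl.le, a.le⟩, ⟨b.le, c.le⟩,
        (gamma23_mem_finiteOval κ q).2.2.1.2 ⟨f.le, g.le⟩, d.le, e.le⟩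
    · exact Or.inr (Or.inl ⟨⟨hl.le, a.le⟩, (gamma23_mem_finiteOval κ q).2.1.2 f.le,
        ⟨b.le, hr.le⟩, d.le, e.le⟩)
    · exact Or.inr (Or.inr ⟨d.le, ⟨a.le, b.le⟩, ⟨c.le, hr.le⟩,
        (gamma23_mem_finiteOval κ q).2.2.2.2 f.le⟩)
    -- For D_1 = 0 three divisor points sit at double points on Σ₂₃; the matching of the pattern
    -- D_1, D_2 < 0 still applies, as the ovals are closed.
    · exact Or.inr (Or.inl ⟨⟨h01.le, le_rfl⟩, gamma23_infty_mem_finiteOval κ, ⟨b.le, hr.le⟩,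
        zero_le_one, le_rfl⟩)
    -- For D_2 = 0 the points γ₂ and p23 are the two sides of one double point, shared by ovals 1
    -- and 2; one is counted in each, as in the pattern D_1 < 0 < D_2.
    · exact Or.inl ⟨⟨hl.le, a.le⟩, ⟨h12.le, le_rfl⟩,
        (gamma23_mem_finiteOval κ 1).2.2.1.2 ⟨zero_le_one, le_rfl⟩, d.le, e.le⟩
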